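/- Let $n\ge 2$ and let $D\subset\mathbb C^n$ be a $\mathbb C$-convex domain (i.e. a nonempty connected open set whose intersection with every complex affine line meeting $D$ is simply connected) that contains no complex affine line. Let $z\in D$ and let $\mathbb B^n$ be the open Euclidean unit ball. Put $$c_D(z)=\sup\{|\det\psi'(z)|^2:\psi:D\to\mathbb B^n \text{ holomorphic},\ \psi(z)=0\},$$ $$k_D(z)=\inf\{|\det\psi'(0)|^{-2}:\psi:\mathbb B^n\to D \text{ holomorphic},\ \psi(0)=z\},$$ where $|\det\psi'(0)|^{-2}=+\infty$ if $\det\psi'(0)=0$. Choose points $p^1,\dots,p^n\in\partial D$ successively as follows: for $j=1,\dots,n$, let $H_{j-1}$ be the complex affine subspace through $z$ orthogonal to $p^1-z,\dots,p^{j-1}-z$ (so $H_0=\mathbb C^n$), and let $p^j$ be a point of $\partial D\cap H_{j-1}$ at minimal distance $\tau_j=\|p^j-z\|$ from $z$. Put $p_D(z)=\tau_1\cdots\tau_n$. Then such a choice of points exists, and for every such choice $$\frac1{(16n)^n}\le v_D(z)\,p_D(z)^2\le\left(\frac{4^n-1}{3}\right)^n$$ both for $v_D=c_D$ and for $v_D=k_D$.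 -/

import Mathlib

open scoped ENNReal

namespace CConvexVolume

/-- `ℂⁿ` with its standard Hermitian inner product and Euclidean norm. -/
abbrev Cn (n : ℕ) : Type := EuclideanSpace ℂ (Fin n)

/-- A domain: a nonempty connected open set. -/
def IsDomainSet {n : ℕ} (D : Set (Cn n)) : Prop :=
  IsOpen D ∧ IsConnected D

/-- The complex affine line `{a + t v : t ∈ ℂ}` (used with `v ≠ 0`). -/
def complexLine {n : ℕ} (a v : Cn n) : Set (Cn n) :=
  Set.range fun t : ℂ => a + t • v

/-- A set is `ℂ`-convex if its intersection with every complex affine line that meets it is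
simply connected (in particular connected). -/
def IsCConvex {n : ℕ} (D : Set (Cn n)) : Prop :=
  ∀ a v : Cn n, v ≠ 0 → (D ∩ complexLine a v).Nonempty →
    IsSimplyConnected (D ∩ complexLine a v)

/-- A set is non-degenerate if it contains no complex affine line. -/
def IsNondegenerate {n : ℕ} (D : Set (Cn n)) : Prop :=
  ∀ a v : Cn n, v ≠ 0 → ¬ complexLine a v ⊆ D

/-- The Carathéodory volume element: the supremum of `|det ψ'(z)|²` over the holomorphic maps
`ψ` from `D` to the unit ball with `ψ z = 0`. -/
noncomputable def caratheodoryVol {n : ℕ} (D : Set (Cn n)) (z : Cn n) : ℝ≥0∞ :=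
  sSup {r : ℝ≥0∞ | ∃ ψ : Cn n → Cn n, DifferentiableOn ℂ ψ D ∧
    Set.MapsTo ψ D (Metric.ball 0 1) ∧ ψ z = 0 ∧
    r = ENNReal.ofReal (‖(fderiv ℂ ψ z).det‖ ^ 2)}

/-- The Kobayashi–Eisenman volume element: the infimum of `|det ψ'(0)|⁻²` over the holomorphic
maps `ψ` from the unit ball to `D` with `ψ 0 = z`. A map with `det ψ'(0) = 0` contributes `∞`,
as the inverse is taken in `[0, ∞]`. -/
noncomputable def kobayashiVol {n : ℕ} (D : Set (Cn n)) (z : Cn n) : ℝ≥0∞ :=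
  sInf {r : ℝ≥0∞ | ∃ ψ : Cn n → Cn n, DifferentiableOn ℂ ψ (Metric.ball 0 1) ∧
    Set.MapsTo ψ (Metric.ball 0 1) D ∧ ψ 0 = z ∧
    r = (ENNReal.ofReal (‖(fderiv ℂ ψ 0).det‖ ^ 2))⁻¹}

/-- The complex affine subspace through `z` orthogonal to the vectors `p i - z` for `i < j`
(all of `ℂⁿ` for the first index `j`). -/
def orthoSlice {n : ℕ} (z : Cn n) (p : Fin n → Cn n) (j : Fin n) : Set (Cn n) :=
  {w | ∀ i < j, inner ℂ (p i - z) (w - z) = 0}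

/-- `p` is an admissible outcome of the successive choice of nearest boundary points: each `p j`
lies on `∂D`, in the affine subspace through `z` orthogonal to all the earlier `p i - z`, and it
realises the minimum distance from `z` to the part of `∂D` in that subspace. -/
structure IsMinimalFrame {n : ℕ} (D : Set (Cn n)) (z : Cn n) (p : Fin n → Cn n) : Prop where
  mem : ∀ j, p j ∈ frontier D ∩ orthoSlice z p j
  dist_le : ∀ j, ∀ q ∈ frontier D ∩ orthoSlice z p j, dist z (p j) ≤ dist z q

/-- The product `p_D(z) = τ₁ ⋯ τₙ` of the successive minimal distances `τ_j = ‖p j - z‖`. -/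
noncomputable def frameProd {n : ℕ} (z : Cn n) (p : Fin n → Cn n) : ℝ :=
  ∏ j, ‖p j - z‖

end CConvexVolume

namespace CConvexVolume

open Set Filter Topology

/-- Two continuous logarithms of the same function on a preconnected set that agree at one point
agree everywhere. -/
theorem eqOn_of_exp_eq {X : Type*} [TopologicalSpace X] {S : Set X} (hS : IsPreconnected S)
    {f g : X → ℂ} (hf : ContinuousOn f S) (hg : ContinuousOn g S)
    (h : ∀ x ∈ S, Complex.exp (f x) = Complex.exp (g x)) {a : X} (ha : a ∈ S) (hfg : f a = g a) :
    EqOn f g S := by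
  have hmap : ∀ x ∈ S, f x - g x ∈ (AddSubgroup.zmultiples (2 * Real.pi * Complex.I) : Set ℂ) := by
    intro x hx
    obtain ⟨k, hk⟩ := Complex.exp_eq_exp_iff_exists_int.1 (h x hx)
    exact ⟨k, by simp [hk]⟩
  have : DiscreteTopology (AddSubgroup.zmultiples (2 * Real.pi * Complex.I) : Set ℂ) :=
    NormedSpace.discreteTopology_zmultiples _
  intro x hx
  have := hS.constant_of_mapsTo ⟨this⟩ (hf.sub hg) hmap hx ha
  simp only [Pi.sub_apply, hfg, sub_self, sub_eq_zero] at this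
  exact this

/-- A continuous logarithm of a constant on a preconnected set is constant. -/
theorem eq_of_exp_eq_const {X : Type*} [TopologicalSpace X] {S : Set X} (hS : IsPreconnected S)
    {f : X → ℂ} (hf : ContinuousOn f S) {c : ℂ}
    (h : ∀ x ∈ S, Complex.exp (f x) = c) {a b : X} (ha : a ∈ S) (hb : b ∈ S) : f a = f b :=
  (eqOn_of_exp_eq hS continuousOn_const hf (fun x hx => by rw [h x hx, h a ha]) ha rfl hb)

variable {E : Type*} [NormedAddCommGroup E] [NormedSpace ℂ E]

/-- All nonempty slices of `D` by parametrised complex lines are simply connected. -/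
def SliceSimplyConnected (D : Set E) : Prop :=
  ∀ x y : E, {t : ℂ | x + t • y ∈ D}.Nonempty → IsSimplyConnected {t : ℂ | x + t • y ∈ D}

/-- If every point `w` of `W` can be joined to `σ w` inside a simply connected complex slice of the
open set `D`, where `g` takes a constant value on the points `σ w`, then the nowhere zero continuous
function `g` has a continuous logarithm on `W`. -/
theorem exists_log_of_section {D W : Set E} (hD : IsOpen D) (hW : IsOpen W) {g : E → ℂ}
    (hg : ContinuousOn g D) (hg0 : ∀ x ∈ D, g x ≠ 0) {σ : E → E} (hσ : ContinuousOn σ W)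
    (hσD : ∀ w ∈ W, σ w ∈ D) (hWD : W ⊆ D) {l : ℂ} (hl : ∀ w ∈ W, g (σ w) = Complex.exp l)
    (hsc : ∀ w ∈ W, IsSimplyConnected {t : ℂ | σ w + t • (w - σ w) ∈ D}) :
    ∃ φ : E → ℂ, ContinuousOn φ W ∧ ∀ w ∈ W, Complex.exp (φ w) = g w := by
  have key : ∀ w ∈ W, ∃ f : ℂ → ℂ, ContinuousOn f {t : ℂ | σ w + t • (w - σ w) ∈ D} ∧
      (∀ t ∈ {t : ℂ | σ w + t • (w - σ w) ∈ D},
        Complex.exp (f t) = g (σ w + t • (w - σ w))) ∧ f 0 = l := by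
    intro w hw
    have hcont : Continuous fun t : ℂ => σ w + t • (w - σ w) := by fun_prop
    obtain ⟨f, hf, hfe⟩ := Complex.exists_continuousOn_eqOn_exp_comp (hsc w hw)
      (hD.preimage hcont) (g := fun t => g (σ w + t • (w - σ w)))
      (hg.comp hcont.continuousOn fun t ht => ht)
      (by rintro ⟨t, ht, h0⟩; exact hg0 _ ht h0)
    refine ⟨fun t => f t + (l - f 0), hf.add continuousOn_const, fun t ht => ?_, by simp⟩
    have h0 : Complex.exp (f 0) = Complex.exp l := by
      have := hfe (show (0 : ℂ) ∈ {t : ℂ | σ w + t • (w - σ w) ∈ D} by simpa using hσD w hw)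
      simpa [hl w hw] using this
    rw [Complex.exp_add, Complex.exp_sub, h0, div_self (Complex.exp_ne_zero _), mul_one]
    exact hfe ht
  choose! f hf hfe hf0 using key
  refine ⟨fun w => f w 1, ?_, fun w hw => ?_⟩
  swap
  · have := hfe w hw 1 (by simpa using hWD hw)
    simpa using this
  intro w₀ hw₀
  obtain ⟨γ, hγ⟩ := (hsc w₀ hw₀).isPathConnected.joinedIn 0
    (by simpa using hσD w₀ hw₀) 1 (by simpa using hWD hw₀)
  set P : E → unitInterval → E := fun w t => σ w + γ t • (w - σ w) with hP
  have hPc : ∀ t, ContinuousAt (fun q : E × unitInterval => P q.1 q.2) (w₀, t) := by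
    intro t
    have h1 : ContinuousAt (fun q : E × unitInterval => σ q.1) (w₀, t) :=
      ContinuousAt.comp (f := Prod.fst) (hσ.continuousAt (hW.mem_nhds hw₀)) continuousAt_fst
    have h2 : ContinuousAt (fun q : E × unitInterval => γ q.2) (w₀, t) :=
      (γ.continuous.comp continuous_snd).continuousAt
    exact h1.add (h2.smul (continuousAt_fst.sub h1))
  have hPD : ∀ t, P w₀ t ∈ D := fun t => hγ t
  have hgP : ∀ t, ContinuousAt (fun q : E × unitInterval => g (P q.1 q.2)) (w₀, t) := fun t =>
    ContinuousAt.comp (f := fun q : E × unitInterval => P q.1 q.2)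
      (hg.continuousAt (hD.mem_nhds (hPD t))) (hPc t)
  have hgP0 : Continuous fun t => g (P w₀ t) := by
    rw [continuous_iff_continuousAt]
    exact fun t => ContinuousAt.comp (f := fun t => (w₀, t)) (hgP t) (by fun_prop)
  have huni : ∀ ε > 0, ∀ᶠ w in 𝓝 w₀, ∀ t ∈ (univ : Set unitInterval), P w t ∈ D ∧
      dist (g (P w t) / g (P w₀ t)) 1 < ε := by
    intro ε hε
    refine isCompact_univ.eventually_forall_of_forall_eventually fun t _ => ?_
    refine ((hPc t).eventually (hD.mem_nhds (hPD t))).and ?_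
    have hq : ContinuousAt (fun q : E × unitInterval => g (P q.1 q.2) / g (P w₀ q.2)) (w₀, t) :=
      (hgP t).div (hgP0.comp continuous_snd).continuousAt (hg0 _ (hPD t))
    have h1 : g (P w₀ t) / g (P w₀ t) = 1 := div_self (hg0 _ (hPD t))
    have := hq.eventually (Metric.ball_mem_nhds _ hε)
    simpa [h1] using this
  have hloc : ∀ᶠ w in 𝓝 w₀, f w 1 = f w₀ 1 + Complex.log (g w / g w₀) := by
    filter_upwards [huni 1 one_pos, hW.mem_nhds hw₀] with w hw hwW
    have hpath : ∀ t, γ t ∈ {t : ℂ | σ w + t • (w - σ w) ∈ D} := fun t => (hw t (mem_univ _)).1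
    have hslit : ∀ t, g (P w t) / g (P w₀ t) ∈ Complex.slitPlane := fun t =>
      Complex.ball_one_subset_slitPlane (hw t (mem_univ _)).2
    have hgPw : Continuous fun t => g (P w t) := by
      rw [continuous_iff_continuousAt]
      intro t
      refine ContinuousAt.comp (f := P w) (hg.continuousAt (hD.mem_nhds (hpath t))) ?_
      exact Continuous.continuousAt (by fun_prop)
    have heq := eqOn_of_exp_eq (S := (univ : Set unitInterval)) isPreconnected_univ
      (f := fun t => f w (γ t))
      (g := fun t => f w₀ (γ t) + Complex.log (g (P w t) / g (P w₀ t)))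
      ((hf w hwW).comp γ.continuous.continuousOn fun t _ => hpath t)
      (((hf w₀ hw₀).comp γ.continuous.continuousOn fun t _ => hγ t).add
        (((hgPw.div hgP0 fun t => hg0 _ (hPD t)).clog hslit).continuousOn))
      (fun t _ => ?_) (mem_univ 0) ?_
    · simpa [hP] using heq (mem_univ 1)
    · have h1 := hg0 _ (hPD t)
      rw [hfe w hwW _ (hpath t), Complex.exp_add, hfe w₀ hw₀ _ (hγ t),
        Complex.exp_log (div_ne_zero (hg0 _ (hpath t)) h1)]
      exact (mul_div_cancel₀ _ h1).symm
    · simp [hP, hf0 w hwW, hf0 w₀ hw₀, hl w hwW, hl w₀ hw₀]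
  refine ContinuousAt.continuousWithinAt ?_
  have hgw : g w₀ ≠ 0 := hg0 _ (hWD hw₀)
  have hlim : ContinuousAt (fun w => f w₀ 1 + Complex.log (g w / g w₀)) w₀ := by
    refine continuousAt_const.add (ContinuousAt.clog ?_ (by simp [hgw]))
    exact (hg.continuousAt (hD.mem_nhds (hWD hw₀))).div_const _
  exact hlim.congr (hloc.mono fun w h => h.symm)

end CConvexVolume

namespace CConvexVolume

open Set Filter Topology

variable {E : Type*} [NormedAddCommGroup E] [NormedSpace ℂ E]

theorem eq_of_exp_eq_on_slice {D S : Set E} (hsc : SliceSimplyConnected D) {x y : E}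
    (hx : x ∈ D) (hy : y ∈ D) {φ : E → ℂ} (hφ : ContinuousOn φ S) {c : ℂ}
    (h : ∀ t : ℂ, x + t • (y - x) ∈ D → x + t • (y - x) ∈ S ∧
      Complex.exp (φ (x + t • (y - x))) = c) : φ x = φ y := by
  have h0 : (0 : ℂ) ∈ {t : ℂ | x + t • (y - x) ∈ D} := by simpa using hx
  have h1 : (1 : ℂ) ∈ {t : ℂ | x + t • (y - x) ∈ D} := by simpa using hy
  have hconn := (hsc x (y - x) ⟨0, h0⟩).isPathConnected.isConnected.isPreconnected
  have := eq_of_exp_eq_const hconn (f := fun t => φ (x + t • (y - x)))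
    (hφ.comp (Continuous.continuousOn (by fun_prop)) fun t ht => (h t ht).1)
    (fun t ht => (h t ht).2) h0 h1
  simpa using this

/-- A nowhere zero continuous function on the image of a set with simply connected slices under
a linear functional has a continuous logarithm. -/
theorem exists_log_on_image {D : Set E} (hD : IsOpen D) (hsc : SliceSimplyConnected D)
    (L : E →L[ℂ] ℂ) {u : E} (hu : L u = 1) {h : ℂ → ℂ} (hh : ContinuousOn h (L '' D))
    (h0 : ∀ c ∈ L '' D, h c ≠ 0) :
    ∃ f : ℂ → ℂ, ContinuousOn f (L '' D) ∧ ∀ c ∈ L '' D, Complex.exp (f c) = h c := by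
  rcases D.eq_empty_or_nonempty with rfl | ⟨z, hz⟩
  · exact ⟨0, by simp⟩
  have hz0 := h0 _ (mem_image_of_mem L hz)
  obtain ⟨φ, hφ, hφe⟩ := exists_log_of_section (W := D) (σ := fun _ => z) (l := Complex.log (h (L z)))
    hD hD
    (hh.comp L.continuous.continuousOn (mapsTo_image L D)) (fun x hx => h0 _ (mem_image_of_mem L hx))
    continuousOn_const (fun _ _ => hz) Subset.rfl
    (fun w _ => by rw [Complex.exp_log hz0]; rfl)
    (fun w hw => hsc _ _ ⟨0, by simpa using hz⟩)
  have hconst : ∀ x ∈ D, ∀ y ∈ D, L x = L y → φ x = φ y := by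
    intro x hx y hy hxy
    refine eq_of_exp_eq_on_slice hsc hx hy hφ (c := h (L x)) fun t ht => ⟨ht, ?_⟩
    rw [hφe _ ht]
    simp [hxy]
  choose! s hs hLs using fun (c : ℂ) (hc : c ∈ L '' D) => hc
  refine ⟨fun c => φ (s c), ?_, fun c hc => ?_⟩
  · rintro _ ⟨x, hx, rfl⟩
    refine ContinuousAt.continuousWithinAt ?_
    set q : ℂ → E := fun c => x + (c - L x) • u with hq
    have hqc : Continuous q := by fun_prop
    have hqx : q (L x) = x := by simp [hq]
    have hLq : ∀ c, L (q c) = c := fun c => by simp [hq, hu]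
    have hqD : ∀ᶠ c in 𝓝 (L x), q c ∈ D :=
      hqc.continuousAt.eventually (by rw [hqx]; exact hD.mem_nhds hx)
    have hcont : ContinuousAt (fun c => φ (q c)) (L x) :=
      ContinuousAt.comp (f := q) (by rw [hqx]; exact hφ.continuousAt (hD.mem_nhds hx))
        hqc.continuousAt
    refine hcont.congr (hqD.mono fun c hc => ?_)
    have hcm : c ∈ L '' D := ⟨_, hc, hLq c⟩
    exact hconst _ hc _ (hs c hcm) (by rw [hLq, hLs c hcm])
  · rw [hφe _ (hs c hc)]
    simp [hLs c hc]

theorem isSimplyConnected_univ_complex : IsSimplyConnected (univ : Set ℂ) := by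
  have : SimplyConnectedSpace ℂ := inferInstance
  exact (Homeomorph.Set.univ ℂ).toHomotopyEquiv.simplyConnectedSpace_iff.2 this

/-- If the fibres `{l₂ = c l₁}` all meet `D`, and `l₁, l₂` have no common zero in `D`, then `l₁` has a
continuous logarithm off its zero set. -/
theorem exists_log_of_fibres {D : Set E} (hD : IsOpen D) (hsc : SliceSimplyConnected D)
    {l₁ l₂ : E →L[ℂ] ℂ} {u : E} (hu₁ : l₁ u = 0) (hu₂ : l₂ u = 1)
    (hne : ∀ c : ℂ, ∃ x ∈ D, l₂ x = c * l₁ x) (hz : ∀ x ∈ D, l₁ x = 0 → l₂ x ≠ 0) :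
    ∃ φ : E → ℂ, ContinuousOn φ (D ∩ {x | l₁ x ≠ 0}) ∧
      ∀ x ∈ D ∩ {x | l₁ x ≠ 0}, Complex.exp (φ x) = l₁ x := by
  set D' : Set E := D ∩ {x | l₁ x ≠ 0} with hD'
  have hD'o : IsOpen D' := hD.inter (isOpen_ne_fun l₁.continuous continuous_const)
  set h : E → ℂ := fun x => l₂ x / l₁ x with hh
  have hhc : ContinuousOn h D' :=
    l₂.continuous.continuousOn.div l₁.continuous.continuousOn fun x hx => hx.2
  -- the slice through two points of a fibre stays in the fibre
  have hslice : ∀ x ∈ D', ∀ y ∈ D', h x = h y → ∀ t : ℂ, x + t • (y - x) ∈ D →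
      x + t • (y - x) ∈ D' ∧ h (x + t • (y - x)) = h x := by
    intro x hx y hy hxy t ht
    have e1 : l₂ x = h x * l₁ x := (div_mul_cancel₀ _ hx.2).symm
    have e2 : l₂ y = h x * l₁ y := by rw [hxy]; exact (div_mul_cancel₀ _ hy.2).symm
    have e3 : l₂ (x + t • (y - x)) = h x * l₁ (x + t • (y - x)) := by
      simp only [map_add, map_smul, map_sub, smul_eq_mul, e1, e2]; ring
    have h0 : l₁ (x + t • (y - x)) ≠ 0 := fun h0 => hz _ ht h0 (by rw [e3, h0, mul_zero])
    exact ⟨⟨ht, h0⟩, by rw [hh]; simp only; rw [e3, mul_div_cancel_right₀ _ h0]⟩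
  have hpt : ∀ c : ℂ, ∃ x ∈ D', h x = c := by
    intro c
    obtain ⟨x, hx, hxc⟩ := hne c
    have h0 : l₁ x ≠ 0 := fun h0 => hz _ hx h0 (by rw [hxc, h0, mul_zero])
    exact ⟨x, ⟨hx, h0⟩, by rw [hh]; simp only; rw [hxc, mul_div_cancel_right₀ _ h0]⟩
  -- local sections of `h`
  have hsec : ∀ x ∈ D', ∃ q : ℂ → E, Continuous q ∧ q (h x) = x ∧ (∀ c, l₁ (q c) = l₁ x) ∧
      (∀ c, h (q c) = c) ∧ ∀ᶠ c in 𝓝 (h x), q c ∈ D' := by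
    intro x hx
    have hqc : Continuous fun c : ℂ => x + ((c - h x) * l₁ x) • u := by fun_prop
    have hl : ∀ c : ℂ, l₁ (x + ((c - h x) * l₁ x) • u) = l₁ x := fun c => by simp [hu₁]
    refine ⟨fun c => x + ((c - h x) * l₁ x) • u, hqc, by simp, hl, fun c => ?_, ?_⟩
    · have e1 : l₂ x = h x * l₁ x := (div_mul_cancel₀ _ hx.2).symm
      have : l₂ (x + ((c - h x) * l₁ x) • u) = c * l₁ x := by
        simp only [map_add, map_smul, smul_eq_mul, hu₂, e1]; ring
      simp only [hh]
      simp only [hh] at this hl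
      rw [this, hl, mul_div_cancel_right₀ _ hx.2]
    · exact hqc.continuousAt.eventually (by simpa using hD'o.mem_nhds hx)
  -- local logarithms
  have hlocal : ∀ c₀ : ℂ, ∃ r > 0, ∃ φ : E → ℂ,
      ContinuousOn φ (D' ∩ h ⁻¹' Metric.ball c₀ r) ∧
      ∀ x ∈ D' ∩ h ⁻¹' Metric.ball c₀ r, Complex.exp (φ x) = l₁ x := by
    intro c₀
    obtain ⟨x₀, hx₀, rfl⟩ := hpt c₀
    obtain ⟨q, hqc, -, hq1, hqh, hqD⟩ := hsec x₀ hx₀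
    obtain ⟨r, hr, hball⟩ := Metric.eventually_nhds_iff_ball.1 hqD
    refine ⟨r, hr, ?_⟩
    refine exists_log_of_section (σ := fun w => q (h w)) (l := Complex.log (l₁ x₀)) hD'o
      (hhc.isOpen_inter_preimage hD'o Metric.isOpen_ball) l₁.continuous.continuousOn
      (fun x hx => hx.2) (hqc.comp_continuousOn (hhc.mono inter_subset_left))
      (fun w hw => hball _ hw.2) inter_subset_left
      (fun w hw => by rw [Complex.exp_log hx₀.2, hq1]) fun w hw => ?_
    have hqw := hball _ hw.2
    have : {t : ℂ | q (h w) + t • (w - q (h w)) ∈ D'} =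
        {t : ℂ | q (h w) + t • (w - q (h w)) ∈ D} := by
      ext t
      exact ⟨fun ht => ht.1, fun ht => (hslice _ hqw _ hw.1 (hqh _) t ht).1⟩
    rw [this]
    exact hsc _ _ ⟨0, by simpa using hqw.1⟩
  choose r hr φ hφ hφe using hlocal
  obtain ⟨χ, hχ⟩ := PartitionOfUnity.exists_isSubordinate (s := (univ : Set ℂ)) isClosed_univ
    (fun c => Metric.ball c (r c)) (fun c => Metric.isOpen_ball)
    (fun c _ => mem_iUnion.2 ⟨c, Metric.mem_ball_self (hr c)⟩)
  set ρ : E → ℂ := fun x => ∑ᶠ i, χ i (h x) • φ i x with hρ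
  have hρc : ContinuousOn ρ D' := by
    rw [continuousOn_iff_continuous_domRestrict]
    have hres : Continuous fun x : D' => h x := continuousOn_iff_continuous_domRestrict.1 hhc
    refine continuous_finsum (f := fun i (x : D') => χ i (h x) • φ i x) (fun i => ?_) ?_
    · rw [continuous_iff_continuousAt]
      intro x
      by_cases hx : h x ∈ Metric.ball i (r i)
      · refine ((χ i).continuous.comp hres).continuousAt.smul ?_
        refine ContinuousAt.comp (f := fun x : D' => (x : E)) ?_ continuous_subtype_val.continuousAt
        exact (hφ i).continuousAt
          ((hhc.isOpen_inter_preimage hD'o Metric.isOpen_ball).mem_nhds ⟨x.2, hx⟩)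
      · have hx' : h x ∈ (tsupport (χ i))ᶜ := fun h' => hx (hχ i h')
        have : ∀ᶠ y : D' in 𝓝 x, h y ∈ (tsupport (χ i))ᶜ :=
          hres.continuousAt.eventually ((isClosed_tsupport _).isOpen_compl.mem_nhds hx')
        refine (continuousAt_const (y := (0 : ℂ))).congr (this.mono fun y hy => ?_)
        simp only [image_eq_zero_of_notMem_tsupport hy, zero_smul]
    · refine (χ.locallyFinite.preimage_continuous hres).subset fun i x hx => ?_
      simp only [mem_preimage, Function.mem_support] at hx ⊢
      exact fun h0 => hx (by rw [h0, zero_smul])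
  have hρs : ∀ x, ρ x = ∑ i ∈ χ.finsupport (h x), χ i (h x) • φ i x := by
    intro x
    refine finsum_eq_sum_of_support_subset _ fun i hi => ?_
    rw [PartitionOfUnity.coe_finsupport]
    simp only [Function.mem_support] at hi ⊢
    exact fun h0 => hi (by rw [h0, zero_smul])
  have hfib : ∀ x ∈ D', ∀ y ∈ D', h x = h y →
      Complex.exp (ρ x) / l₁ x = Complex.exp (ρ y) / l₁ y := by
    intro x hx y hy hxy
    set j := h x with hj
    have hmem : ∀ i ∈ χ.finsupport j, j ∈ Metric.ball i (r i) := fun i hi => by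
      rw [PartitionOfUnity.mem_finsupport] at hi
      exact hχ i (subset_tsupport _ hi)
    have hjj : j ∈ Metric.ball j (r j) := Metric.mem_ball_self (hr j)
    have hdiff : ∀ i ∈ χ.finsupport j, φ i x = (φ j x - φ j y) + φ i y := by
      intro i hi
      have := eq_of_exp_eq_on_slice hsc hx.1 hy.1 (φ := fun w => φ i w - φ j w) (c := 1)
        (S := (D' ∩ h ⁻¹' Metric.ball i (r i)) ∩ (D' ∩ h ⁻¹' Metric.ball j (r j)))
        (((hφ i).mono inter_subset_left).sub ((hφ j).mono inter_subset_right)) fun t ht => ?_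
      · linear_combination this
      · obtain ⟨h1, h2⟩ := hslice x hx y hy hxy t ht
        have m1 : x + t • (y - x) ∈ D' ∩ h ⁻¹' Metric.ball i (r i) :=
          ⟨h1, by rw [mem_preimage, h2]; exact hmem i hi⟩
        have m2 : x + t • (y - x) ∈ D' ∩ h ⁻¹' Metric.ball j (r j) :=
          ⟨h1, by rw [mem_preimage, h2]; exact hjj⟩
        exact ⟨⟨m1, m2⟩, by
          rw [Complex.exp_sub, hφe i _ m1, hφe j _ m2, div_self h1.2]⟩
    have hsum : ∑ i ∈ χ.finsupport j, χ i j = 1 := χ.sum_finsupport (mem_univ j)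
    have hρxy : ρ x = (φ j x - φ j y) + ρ y := by
      rw [hρs x, hρs y, ← hxy, ← hj, Finset.sum_congr rfl fun i hi => by rw [hdiff i hi]]
      simp only [smul_add, Finset.sum_add_distrib, ← Finset.sum_smul, hsum, one_smul]
    rw [hρxy, Complex.exp_add, Complex.exp_sub, hφe j x ⟨hx, hjj⟩,
      hφe j y ⟨hy, by rw [mem_preimage, ← hxy]; exact hjj⟩]
    have h1 : l₁ x ≠ 0 := hx.2
    have h2 : l₁ y ≠ 0 := hy.2
    field_simp
  choose s hs hhs using hpt
  set m : ℂ → ℂ := fun c => Complex.exp (ρ (s c)) / l₁ (s c) with hm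
  have hmc : Continuous m := by
    rw [continuous_iff_continuousAt]
    intro c
    obtain ⟨q, hqc, hqx, hq1, hqh, hqD⟩ := hsec (s c) (hs c)
    rw [hhs c] at hqx hqD
    have hcont : ContinuousAt (fun c => Complex.exp (ρ (q c)) / l₁ (q c)) c := by
      refine ContinuousAt.div ?_ (by fun_prop) (by rw [hqx]; exact (hs c).2)
      refine Complex.continuous_exp.continuousAt.comp ?_
      refine ContinuousAt.comp (f := q) (g := ρ) ?_ hqc.continuousAt
      rw [hqx]
      exact hρc.continuousAt (hD'o.mem_nhds (hs c))
    exact hcont.congr (hqD.mono fun d hd => hfib _ hd _ (hs d) (by rw [hqh, hhs]))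
  obtain ⟨μ, hμ, hμe⟩ := Complex.exists_continuousOn_eqOn_exp_comp isSimplyConnected_univ_complex
    isOpen_univ hmc.continuousOn (by
      rintro ⟨c, -, hc⟩
      exact div_ne_zero (Complex.exp_ne_zero _) (hs c).2 hc)
  refine ⟨fun x => ρ x - μ (h x), hρc.sub (hμ.comp hhc (mapsTo_univ _ _)), fun x hx => ?_⟩
  have h1 : Complex.exp (μ (h x)) = m (h x) := hμe (mem_univ _)
  rw [Complex.exp_sub, h1, hm]
  simp only
  rw [hfib _ (hs (h x)) _ hx (hhs _), div_div_cancel₀ (Complex.exp_ne_zero _)]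

/-- The identity has no continuous logarithm on the punctured plane. -/
theorem not_exists_log_id {m : ℂ → ℂ} (hm : ContinuousOn m {0}ᶜ)
    (he : ∀ c : ℂ, c ≠ 0 → Complex.exp (m c) = c) : False := by
  have key := eqOn_of_exp_eq (S := (univ : Set ℝ)) isPreconnected_univ
    (f := fun θ => m (Complex.exp (θ * Complex.I))) (g := fun θ => θ * Complex.I + m 1)
    (hm.comp (Continuous.continuousOn (by fun_prop)) fun θ _ => Complex.exp_ne_zero _)
    (Continuous.continuousOn (by fun_prop))
    (fun θ _ => by rw [he _ (Complex.exp_ne_zero _), Complex.exp_add, he 1 one_ne_zero, mul_one])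
    (mem_univ 0) (by simp) (mem_univ (2 * Real.pi))
  have h2 := Complex.two_pi_I_ne_zero
  simp only [Complex.ofReal_mul, Complex.ofReal_ofNat, Complex.exp_two_pi_mul_I] at key
  exact h2 (by linear_combination -key)

/-- If two independent functionals have no common zero in `D`, then some nontrivial combination of
them has no zero in `D`. -/
theorem exists_combination_ne_zero {D : Set E} (hD : IsOpen D) (hsc : SliceSimplyConnected D)
    {l₁ l₂ : E →L[ℂ] ℂ} {u₁ u₂ : E} (h11 : l₁ u₁ = 1) (h12 : l₁ u₂ = 0) (h21 : l₂ u₁ = 0)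
    (h22 : l₂ u₂ = 1) (hz : ∀ x ∈ D, l₁ x = 0 → l₂ x ≠ 0) :
    ∃ α β : ℂ, (α ≠ 0 ∨ β ≠ 0) ∧ ∀ x ∈ D, α * l₁ x + β * l₂ x ≠ 0 := by
  by_contra! hcon
  have hne₁ : ∀ c : ℂ, ∃ x ∈ D, l₂ x = c * l₁ x := fun c => by
    obtain ⟨x, hx, h⟩ := hcon (-c) 1 (Or.inr one_ne_zero)
    exact ⟨x, hx, by linear_combination h⟩
  have hne₂ : ∀ c : ℂ, ∃ x ∈ D, l₁ x = c * l₂ x := fun c => by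
    obtain ⟨x, hx, h⟩ := hcon 1 (-c) (Or.inl one_ne_zero)
    exact ⟨x, hx, by linear_combination h⟩
  obtain ⟨φ₁, hφ₁, he₁⟩ := exists_log_of_fibres hD hsc h12 h22 hne₁ hz
  obtain ⟨φ₂, hφ₂, he₂⟩ := exists_log_of_fibres hD hsc h21 h11 hne₂ fun x hx h2 h1 => hz x hx h1 h2
  set S : Set E := (D ∩ {x | l₁ x ≠ 0}) ∩ (D ∩ {x | l₂ x ≠ 0}) with hS
  have hSo : IsOpen S := (hD.inter (isOpen_ne_fun l₁.continuous continuous_const)).inter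
    (hD.inter (isOpen_ne_fun l₂.continuous continuous_const))
  have hψ : ContinuousOn (fun x => φ₂ x - φ₁ x) S :=
    (hφ₂.mono inter_subset_right).sub (hφ₁.mono inter_subset_left)
  have hψe : ∀ x ∈ S, Complex.exp (φ₂ x - φ₁ x) = l₂ x / l₁ x := fun x hx => by
    rw [Complex.exp_sub, he₁ x hx.1, he₂ x hx.2]
  have hmemS : ∀ c : ℂ, c ≠ 0 → ∀ x ∈ D, l₂ x = c * l₁ x → x ∈ S := by
    intro c hc x hx hxc
    have h1 : l₁ x ≠ 0 := fun h1 => hz x hx h1 (by rw [hxc, h1, mul_zero])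
    exact ⟨⟨hx, h1⟩, hx, by simpa [hxc] using ⟨hc, h1⟩⟩
  have hconst : ∀ c : ℂ, c ≠ 0 → ∀ x ∈ D, ∀ y ∈ D, l₂ x = c * l₁ x → l₂ y = c * l₁ y →
      φ₂ x - φ₁ x = φ₂ y - φ₁ y := by
    intro c hc x hx y hy hxc hyc
    refine eq_of_exp_eq_on_slice hsc hx hy (φ := fun x => φ₂ x - φ₁ x) hψ (c := c) fun t ht => ?_
    have e : l₂ (x + t • (y - x)) = c * l₁ (x + t • (y - x)) := by
      simp only [map_add, map_smul, map_sub, smul_eq_mul, hxc, hyc]; ring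
    have hm := hmemS c hc _ ht e
    refine ⟨hm, ?_⟩
    rw [hψe _ hm, e, mul_div_cancel_right₀ _ hm.1.2]
  choose s hsD hsc' using hne₁
  refine not_exists_log_id (m := fun c => φ₂ (s c) - φ₁ (s c)) (fun c hc => ?_) fun c hc => ?_
  · have hcS := hmemS c hc _ (hsD c) (hsc' c)
    refine ContinuousAt.continuousWithinAt ?_
    set q : ℂ → E := fun d => s c + ((d - c) * l₁ (s c)) • u₂ with hq
    have hqc : Continuous q := by fun_prop
    have hqx : q c = s c := by simp [hq]
    have hqD : ∀ᶠ d in 𝓝 c, q d ∈ D ∧ d ≠ 0 :=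
      (hqc.continuousAt.eventually (by rw [hqx]; exact hD.mem_nhds (hsD c))).and
        (isOpen_ne.mem_nhds hc)
    have hcont : ContinuousAt (fun d => φ₂ (q d) - φ₁ (q d)) c :=
      ContinuousAt.comp (f := q) (g := fun x => φ₂ x - φ₁ x)
        (by rw [hqx]; exact hψ.continuousAt (hSo.mem_nhds hcS)) hqc.continuousAt
    refine hcont.congr (hqD.mono fun d hd => ?_)
    refine hconst d hd.2 _ hd.1 _ (hsD d) ?_ (hsc' d)
    simp only [hq, map_add, map_smul, smul_eq_mul, h12, h22, hsc' c]; ring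
  · have hcS := hmemS c hc _ (hsD c) (hsc' c)
    rw [hψe _ hcS, hsc' c, mul_div_cancel_right₀ _ hcS.1.2]

/-- Open sets with simply connected complex slices are linearly convex: through each point of the
complement passes a complex hyperplane that avoids the set. -/
theorem exists_functional_ne_zero [FiniteDimensional ℂ E] {D : Set E} (hD : IsOpen D)
    (hsc : SliceSimplyConnected D) (hDne : D.Nonempty) {a : E} (ha : a ∉ D) :
    ∃ l : E →L[ℂ] ℂ, ∀ w ∈ D, l (w - a) ≠ 0 := by
  obtain ⟨V, hV, hmax⟩ := (wellFounded_gt (α := Submodule ℂ E)).has_min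
    {V | ∀ v ∈ V, a + v ∉ D} ⟨⊥, by simpa using ha⟩
  obtain ⟨z, hz⟩ := hDne
  have hu₁ : z - a ∉ V := fun h => hV _ h (by simpa using hz)
  set u₁ := z - a with hu₁def
  by_cases htop : V ⊔ Submodule.span ℂ {u₁} = ⊤
  · obtain ⟨f, hf, hVf⟩ := Submodule.exists_le_ker_of_notMem hu₁
    refine ⟨f.toContinuousLinearMap, fun w hw h0 => ?_⟩
    have h0 : f (w - a) = 0 := h0
    have hmem : w - a ∈ V ⊔ Submodule.span ℂ {u₁} := htop ▸ Submodule.mem_top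
    obtain ⟨v, hv, y, hy, hvy⟩ := Submodule.mem_sup.1 hmem
    obtain ⟨t, rfl⟩ := Submodule.mem_span_singleton.1 hy
    have hfv : f v = 0 := hVf hv
    rw [← hvy, map_add, hfv, zero_add, map_smul, smul_eq_mul] at h0
    have ht : t = 0 := (mul_eq_zero.1 h0).resolve_right hf
    refine hV v hv ?_
    have : a + v = w := by
      rw [ht, zero_smul, add_zero] at hvy; rw [hvy]; abel
    rwa [this]
  · obtain ⟨u₂, hu₂⟩ : ∃ u₂, u₂ ∉ V ⊔ Submodule.span ℂ {u₁} := by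
      by_contra! h; exact htop (eq_top_iff.2 fun x _ => h x)
    obtain ⟨f₂, hf₂, hVf₂⟩ := Submodule.exists_le_ker_of_notMem hu₂
    have hu₁' : u₁ ∉ V ⊔ Submodule.span ℂ {u₂} := by
      intro h
      obtain ⟨v, hv, y, hy, hvy⟩ := Submodule.mem_sup.1 h
      obtain ⟨t, rfl⟩ := Submodule.mem_span_singleton.1 hy
      have ht : t ≠ 0 := by
        rintro rfl
        exact hu₁ (by rw [← hvy]; simpa using hv)
      refine hu₂ ?_
      have : u₂ = t⁻¹ • (u₁ - v) := by rw [← hvy]; simp [smul_smul, ht]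
      rw [this]
      refine Submodule.smul_mem _ _ (Submodule.sub_mem _ ?_ (Submodule.mem_sup_left hv))
      exact Submodule.mem_sup_right (Submodule.mem_span_singleton_self _)
    obtain ⟨f₁, hf₁, hVf₁⟩ := Submodule.exists_le_ker_of_notMem hu₁'
    have e12 : f₁ u₂ = 0 :=
      hVf₁ (Submodule.mem_sup_right (Submodule.mem_span_singleton_self _))
    have e21 : f₂ u₁ = 0 :=
      hVf₂ (Submodule.mem_sup_right (Submodule.mem_span_singleton_self _))
    have eV₁ : ∀ v ∈ V, f₁ v = 0 := fun v hv => hVf₁ (Submodule.mem_sup_left hv)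
    have eV₂ : ∀ v ∈ V, f₂ v = 0 := fun v hv => hVf₂ (Submodule.mem_sup_left hv)
    set T : Submodule ℂ E := V ⊔ Submodule.span ℂ {u₁} ⊔ Submodule.span ℂ {u₂} with hT
    have hT₁ : u₁ ∈ T := Submodule.mem_sup_left
      (Submodule.mem_sup_right (Submodule.mem_span_singleton_self _))
    have hT₂ : u₂ ∈ T := Submodule.mem_sup_right (Submodule.mem_span_singleton_self _)
    have hTdec : ∀ x ∈ T, ∃ v ∈ V, ∃ s t : ℂ, x = v + s • u₁ + t • u₂ := by
      intro x hx
      obtain ⟨y, hy, y', hy', rfl⟩ := Submodule.mem_sup.1 hx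
      obtain ⟨v, hv, y'', hy'', rfl⟩ := Submodule.mem_sup.1 hy
      obtain ⟨t, rfl⟩ := Submodule.mem_span_singleton.1 hy'
      obtain ⟨s, rfl⟩ := Submodule.mem_span_singleton.1 hy''
      exact ⟨v, hv, s, t, rfl⟩
    obtain ⟨α, β, hαβ, hne⟩ := exists_combination_ne_zero (E := T)
      (D := {x : T | a + (x : E) ∈ D}) (hD.preimage (by fun_prop))
      (fun x y hxy => by
        have := hsc (a + x) y (by simpa [add_assoc] using hxy)
        simpa [add_assoc] using this)
      (l₁ := ((f₁ u₁)⁻¹ • f₁ ∘ₗ T.subtype).toContinuousLinearMap)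
      (l₂ := ((f₂ u₂)⁻¹ • f₂ ∘ₗ T.subtype).toContinuousLinearMap)
      (u₁ := ⟨u₁, hT₁⟩) (u₂ := ⟨u₂, hT₂⟩) (by simp [hf₁]) (by simp [e12]) (by simp [e21])
      (by simp [hf₂]) (by
        rintro ⟨x, hx⟩ hxD h1 h2
        obtain ⟨v, hv, s, t, rfl⟩ := hTdec x hx
        simp [eV₁ v hv, e12, hf₁] at h1
        simp [eV₂ v hv, e21, hf₂] at h2
        refine hV v hv ?_
        simpa [h1, h2] using hxD)
    set u := β • u₁ - α • u₂ with hu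
    have huV : u ∉ V := by
      intro h
      have h1 := eV₁ _ h
      have h2 := eV₂ _ h
      simp [hu, e12, hf₁] at h1
      simp [hu, e21, hf₂] at h2
      rcases hαβ with h | h
      · exact h h2
      · exact h h1
    refine absurd ?_ (hmax (V ⊔ Submodule.span ℂ {u}) fun x hx hxD => ?_)
    · refine lt_of_le_of_ne le_sup_left fun h => huV ?_
      rw [h]
      exact Submodule.mem_sup_right (Submodule.mem_span_singleton_self _)
    · obtain ⟨v, hv, y, hy, rfl⟩ := Submodule.mem_sup.1 hx
      obtain ⟨t, rfl⟩ := Submodule.mem_span_singleton.1 hy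
      have hxT : v + t • u ∈ T := by
        refine T.add_mem (Submodule.mem_sup_left (Submodule.mem_sup_left hv)) (T.smul_mem _ ?_)
        exact T.sub_mem (T.smul_mem _ hT₁) (T.smul_mem _ hT₂)
      refine hne ⟨v + t • u, hxT⟩ hxD ?_
      simp [eV₁ v hv, eV₂ v hv, hu, e12, e21]
      field_simp
      ring

/-- A `ℂ`-convex set has simply connected slices. -/
theorem IsCConvex.sliceSimplyConnected {n : ℕ} {D : Set (Cn n)} (h : IsCConvex D) :
    SliceSimplyConnected D := by
  intro x y hne
  by_cases hy : y = 0
  · subst hy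
    obtain ⟨t, ht⟩ := hne
    have : {t : ℂ | x + t • (0 : Cn n) ∈ D} = univ := by
      ext s; simpa using ht
    rw [this]
    exact isSimplyConnected_univ_complex
  · have hemb : Topology.IsClosedEmbedding fun t : ℂ => x + t • y :=
      (Homeomorph.addLeft x).isClosedEmbedding.comp (isClosedEmbedding_smul_left hy)
    have himg : (fun t : ℂ => x + t • y) '' {t : ℂ | x + t • y ∈ D} = D ∩ complexLine x y := by
      ext w
      constructor
      · rintro ⟨t, ht, rfl⟩; exact ⟨ht, t, rfl⟩
      · rintro ⟨hw, t, rfl⟩; exact ⟨t, hw, rfl⟩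
    rw [← hemb.isEmbedding.isSimplyConnected_image, himg]
    refine h x y hy ?_
    rw [← himg]
    exact hne.image _

end CConvexVolume

namespace CConvexVolume

open Set Filter Topology MeasureTheory Metric

/-- The area of a plane set in the metric `|dw| / |w|`. -/
noncomputable def logArea (S : Set ℂ) : ℝ≥0∞ :=
  ∫⁻ w in S, ENNReal.ofReal ((‖w‖ ^ 2)⁻¹)

theorem hasFDerivWithinAt_real {f : ℂ → ℂ} {s : Set ℂ} {x a : ℂ} (h : HasDerivAt f a x) :
    HasFDerivWithinAt f ((ContinuousLinearMap.toSpanSingleton ℂ a).restrictScalars ℝ) s x :=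
  (h.hasFDerivAt.restrictScalars ℝ).hasFDerivWithinAt

theorem abs_det_toSpanSingleton (a : ℂ) :
    |((ContinuousLinearMap.toSpanSingleton ℂ a).restrictScalars ℝ).det| = ‖a‖ ^ 2 := by
  have h : (((ContinuousLinearMap.toSpanSingleton ℂ a : ℂ →L[ℂ] ℂ) : ℂ →ₗ[ℂ] ℂ)).det = a := by
    rw [← LinearMap.det_toMatrix (Module.Basis.singleton Unit ℂ)]
    simp [LinearMap.toMatrix_apply]
  have h2 : ((ContinuousLinearMap.toSpanSingleton ℂ a).restrictScalars ℝ).det = ‖a‖ ^ 2 := by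
    change (((ContinuousLinearMap.toSpanSingleton ℂ a : ℂ →L[ℂ] ℂ) :
      ℂ →ₗ[ℂ] ℂ).restrictScalars ℝ).det = _
    rw [LinearMap.det_restrictScalars, h, Algebra.norm_complex_apply, Complex.normSq_eq_norm_sq]
  rw [h2, abs_of_nonneg (by positivity)]

theorem logArea_image {f f' : ℂ → ℂ} {s : Set ℂ} (hs : MeasurableSet s)
    (hf : ∀ x ∈ s, HasDerivAt f (f' x) x) (hinj : InjOn f s) :
    logArea (f '' s) = ∫⁻ x in s, ENNReal.ofReal ((‖f' x‖ / ‖f x‖) ^ 2) := by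
  rw [logArea, lintegral_image_eq_lintegral_abs_det_fderiv_mul volume hs
    (fun x hx => hasFDerivWithinAt_real (hf x hx)) hinj]
  refine setLIntegral_congr_fun hs fun x _ => ?_
  rw [abs_det_toSpanSingleton, ← ENNReal.ofReal_mul (by positivity), div_pow, div_eq_mul_inv]

theorem measurableSet_image_of_hasDerivAt {f f' : ℂ → ℂ} {s : Set ℂ} (hs : MeasurableSet s)
    (hf : ∀ x ∈ s, HasDerivAt f (f' x) x) (hinj : InjOn f s) : MeasurableSet (f '' s) :=
  measurable_image_of_fderivWithin hs (fun x hx => hasFDerivWithinAt_real (hf x hx)) hinj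

theorem logArea_inv {s : Set ℂ} (hs : MeasurableSet s) (h0 : (0 : ℂ) ∉ s) :
    logArea ((fun w => w⁻¹) '' s) = logArea s := by
  rw [logArea_image hs (f' := fun w => -(w ^ 2)⁻¹)
    (fun x hx => hasDerivAt_inv fun h => h0 (h ▸ hx)) inv_injective.injOn, logArea]
  refine setLIntegral_congr_fun hs fun x hx => ?_
  have : ‖x‖ ≠ 0 := norm_ne_zero_iff.2 fun h => h0 (h ▸ hx)
  simp only [norm_neg, norm_inv, norm_pow]
  congr 1
  field_simp

theorem setLIntegral_reProdIm (s t : Set ℝ) {F : ℂ → ℝ≥0∞}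
    (hF : AEMeasurable F (volume.restrict (s ×ℂ t))) :
    ∫⁻ ζ in s ×ℂ t, F ζ = ∫⁻ a in s, ∫⁻ θ in t, F (a + θ * Complex.I) := by
  have hpre : Complex.measurableEquivRealProd.symm ⁻¹' (s ×ℂ t) = s ×ˢ t := by
    ext p; simp [Complex.mem_reProdIm, Complex.measurableEquivRealProd]
  have hmp := Complex.volume_preserving_equiv_real_prod.symm
  have hmr := hmp.restrict_preimage_emb Complex.measurableEquivRealProd.symm.measurableEmbedding
    (s ×ℂ t)
  rw [← hmp.setLIntegral_comp_preimage_emb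
    Complex.measurableEquivRealProd.symm.measurableEmbedding F (s ×ℂ t), hpre,
    Measure.volume_eq_prod, setLIntegral_prod]
  · refine lintegral_congr fun a => lintegral_congr fun θ => ?_
    congr 1
    exact Complex.mk_eq_add_mul_I a θ
  · rw [hpre] at hmr
    exact hF.comp_quasiMeasurePreserving hmr.quasiMeasurePreserving

theorem measurableSet_reProdIm {s t : Set ℝ} (hs : MeasurableSet s) (ht : MeasurableSet t) :
    MeasurableSet (s ×ℂ t) :=
  (Complex.measurable_re hs).inter (Complex.measurable_im ht)

theorem injOn_exp_strip (s : Set ℝ) :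
    InjOn Complex.exp (s ×ℂ Ioc (-Real.pi) Real.pi) := fun _ hx _ hy h =>
  Complex.exp_inj_of_neg_pi_lt_of_le_pi hx.2.1 hx.2.2 hy.2.1 hy.2.2 h

theorem logArea_annulus_le {a b : ℝ} :
    logArea {w : ℂ | Real.exp a ≤ ‖w‖ ∧ ‖w‖ ≤ Real.exp b} ≤
      ENNReal.ofReal (2 * Real.pi) * ENNReal.ofReal (b - a) := by
  have hsub : {w : ℂ | Real.exp a ≤ ‖w‖ ∧ ‖w‖ ≤ Real.exp b} ⊆
      Complex.exp '' (Icc a b ×ℂ Ioc (-Real.pi) Real.pi) := by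
    rintro w ⟨h1, h2⟩
    have hw : 0 < ‖w‖ := (Real.exp_pos a).trans_le h1
    refine ⟨Complex.log w, ⟨⟨?_, ?_⟩, Complex.neg_pi_lt_log_im w, Complex.log_im_le_pi w⟩,
      Complex.exp_log (norm_pos_iff.1 hw)⟩
    · rw [Complex.log_re]; exact (Real.le_log_iff_exp_le hw).2 h1
    · rw [Complex.log_re]; exact (Real.log_le_iff_le_exp hw).2 h2
  refine (lintegral_mono_set hsub).trans ?_
  have := logArea_image (f := Complex.exp) (f' := Complex.exp)
    (measurableSet_reProdIm measurableSet_Icc measurableSet_Ioc)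
    (fun x _ => Complex.hasDerivAt_exp x) (injOn_exp_strip (Icc a b))
  rw [logArea] at this
  rw [this]
  simp only [div_self (norm_ne_zero_iff.2 (Complex.exp_ne_zero _)), one_pow, ENNReal.ofReal_one]
  rw [setLIntegral_reProdIm _ _ aemeasurable_const]
  simp only [lintegral_const, Measure.restrict_apply, MeasurableSet.univ, univ_inter,
    Real.volume_Ioc, Real.volume_Icc, one_mul]
  rw [sub_neg_eq_add, ← two_mul]

/-- A holomorphic function equal to `1` at the centre has `L²` mean at least `1` on circles. -/
theorem two_pi_le_lintegral_circle {k : ℂ → ℂ} {R : ℝ} (hk : DifferentiableOn ℂ k (ball 0 R))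
    (hk0 : k 0 = 1) {a : ℝ} (ha : Real.exp a < R) :
    ENNReal.ofReal (2 * Real.pi) ≤ ∫⁻ θ in Ioc (-Real.pi) Real.pi,
      ENNReal.ofReal (‖k (Complex.exp (a + θ * Complex.I))‖ ^ 2) := by
  set q : ℝ → ℂ := fun θ => k (Complex.exp (a + θ * Complex.I)) with hq
  have hnorm : ∀ θ : ℝ, ‖Complex.exp (a + θ * Complex.I)‖ = Real.exp a := fun θ => by
    simp [Complex.norm_exp]
  have hqc : Continuous q := by
    refine hk.continuousOn.comp_continuous (by fun_prop) fun θ => ?_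
    rw [mem_ball_zero_iff, hnorm]; exact ha
  have hper : Function.Periodic q (2 * Real.pi) := by
    intro θ
    simp only [hq]
    congr 1
    rw [show (a : ℂ) + ((θ + 2 * Real.pi : ℝ) : ℂ) * Complex.I =
      (a + θ * Complex.I) + 2 * Real.pi * Complex.I by push_cast; ring, Complex.exp_periodic]
  have hmean : ∫ θ in (-Real.pi)..Real.pi, q θ = 2 * Real.pi := by
    have h1 := (hk.mono (closedBall_subset_ball ha)).diffContOnCl_ball (U := closedBall 0 (Real.exp a))
      (c := 0) (R := Real.exp a) Subset.rfl
    have h2 := DiffContOnCl.circleAverage (R := Real.exp a) (by rwa [Real.abs_exp])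
    rw [hk0, Real.circleAverage_def] at h2
    have h3 : ∀ θ : ℝ, k (circleMap 0 (Real.exp a) θ) = q θ := fun θ => by
      simp [hq, circleMap, Complex.exp_add]
    simp only [h3] at h2
    have h4 := hper.intervalIntegral_add_eq (-Real.pi) 0
    rw [show -Real.pi + 2 * Real.pi = Real.pi by ring, zero_add] at h4
    rw [h4]
    have hpi : (2 * Real.pi : ℝ) ≠ 0 := by positivity
    have := congrArg (fun z : ℂ => (2 * Real.pi : ℝ) • z) h2
    simp only [smul_smul, mul_inv_cancel₀ hpi, one_smul] at this
    rw [this]; simp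
  have hle : -Real.pi ≤ Real.pi := by linarith [Real.pi_pos]
  have hre : ∫ θ in (-Real.pi)..Real.pi, (q θ).re = 2 * Real.pi := by
    have := Complex.reCLM.intervalIntegral_comp_comm (hqc.intervalIntegrable (μ := volume) (-Real.pi) Real.pi)
    simp only [Complex.reCLM_apply] at this
    rw [this, hmean]; simp
  have hsq_le : 2 * Real.pi ≤ ∫ θ in (-Real.pi)..Real.pi, ‖q θ‖ ^ 2 := by
    have h1 : ∫ θ in (-Real.pi)..Real.pi, (2 * (q θ).re - 1) = 2 * Real.pi := by
      rw [intervalIntegral.integral_sub, intervalIntegral.integral_const_mul, hre]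
      · simp; ring
      · exact Continuous.intervalIntegrable (by fun_prop) _ _
      · exact Continuous.intervalIntegrable (by fun_prop) _ _
    rw [← h1]
    refine intervalIntegral.integral_mono_on hle (Continuous.intervalIntegrable (by fun_prop) _ _)
      (Continuous.intervalIntegrable (by fun_prop) _ _) fun θ _ => ?_
    have := Complex.sq_norm (q θ)
    rw [this, Complex.normSq_apply]
    nlinarith [sq_nonneg ((q θ).re - 1), sq_nonneg (q θ).im]
  refine (ENNReal.ofReal_le_ofReal hsq_le).trans (le_of_eq ?_)
  rw [intervalIntegral.integral_of_le hle, ofReal_integral_eq_lintegral_ofReal]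
  · exact (Continuous.integrableOn_Icc (by fun_prop)).mono_set Ioc_subset_Icc_self
  · exact ae_of_all _ fun θ => by positivity

/-- An injective holomorphic function on a disc, vanishing at the centre only to first order, whose
values never have product `1`, has derivative at most the inverse radius at the centre. -/
theorem norm_deriv_mul_le_one_of_mul_ne_one {p : ℂ → ℂ} {R : ℝ} (hR : 0 < R)
    (hp : DifferentiableOn ℂ p (ball 0 R)) (hinj : InjOn p (ball 0 R)) (h0 : p 0 = 0)
    (hd : deriv p 0 ≠ 0) (hBE : ∀ x ∈ ball (0 : ℂ) R, ∀ y ∈ ball (0 : ℂ) R, p x * p y ≠ 1) :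
    ‖deriv p 0‖ * R ≤ 1 := by
  rw [← le_div_iff₀ hR]
  refine le_of_forall_lt_imp_le_of_dense fun c hc => ?_
  rcases le_or_gt c 0 with hc0 | hc0
  · exact hc0.trans (by positivity)
  rw [le_div_iff₀ hR]
  have hball : ball (0 : ℂ) R ∈ 𝓝 (0 : ℂ) := ball_mem_nhds _ hR
  -- the image of a small disc of radius `δ` contains the disc of radius `c δ`
  obtain ⟨η, hη, hsurj⟩ : ∃ η > 0, ∀ w : ℂ, ‖w‖ < η → ∃ x, ‖x‖ ≤ ‖w‖ / c ∧ p x = w := by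
    have hstrict : HasStrictDerivAt p (deriv p 0) 0 :=
      (hp.analyticAt hball).hasStrictDerivAt
    set q := hstrict.localInverse p (deriv p 0) 0 hd with hqdef
    have hq : HasDerivAt q (deriv p 0)⁻¹ (p 0) := (hstrict.to_localInverse hd).hasDerivAt
    have hpq : ∀ᶠ w in 𝓝 (p 0), p (q w) = w := hstrict.eventually_right_inverse hd
    have hqp : ∀ᶠ x in 𝓝 (0 : ℂ), q (p x) = x := hstrict.eventually_left_inverse hd
    have hq0 : q 0 = 0 := by simpa [h0] using hqp.self_of_nhds
    rw [h0] at hq hpq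
    have hslope := (hasDerivAt_iff_tendsto_slope.1 hq).norm
    have hlt : ‖(deriv p 0)⁻¹‖ < c⁻¹ := by
      rw [norm_inv]; exact inv_strictAnti₀ hc0 hc
    have hev := hslope.eventually (gt_mem_nhds hlt)
    rw [eventually_nhdsWithin_iff] at hev
    obtain ⟨η, hη, h⟩ := Metric.eventually_nhds_iff_ball.1 (hev.and hpq)
    refine ⟨η, hη, fun w hw => ⟨q w, ?_, (h w (by simpa using hw)).2⟩⟩
    by_cases hw0 : w = 0
    · simp [hw0, hq0]
    · have h1 := (h w (by simpa using hw)).1 hw0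
      rw [slope_def_field, hq0, sub_zero, sub_zero, norm_div,
        div_lt_iff₀ (norm_pos_iff.2 hw0)] at h1
      rw [div_eq_inv_mul]
      exact h1.le
  set δ : ℝ := min (η / c) R / 2 with hδ
  have hδ0 : 0 < δ := by positivity
  have hδR : δ < R := by
    have := min_le_right (η / c) R
    rw [hδ]; linarith
  have hδη : c * δ < η := by
    have h1 := min_le_left (η / c) R
    have h2 : δ < η / c := by
      have : 0 < η / c := by positivity
      rw [hδ]; linarith
    rwa [lt_div_iff₀ hc0, mul_comm] at h2
  have hcδ : 0 < c * δ := by positivity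
  set Q : Set ℂ := Ioo (Real.log δ) (Real.log R) ×ℂ Ioc (-Real.pi) Real.pi with hQ
  have hQm : MeasurableSet Q := measurableSet_reProdIm measurableSet_Ioo measurableSet_Ioc
  have hQn : ∀ ζ ∈ Q, δ < ‖Complex.exp ζ‖ ∧ ‖Complex.exp ζ‖ < R := by
    intro ζ hζ
    rw [Complex.norm_exp]
    exact ⟨(Real.log_lt_iff_lt_exp hδ0).1 hζ.1.1, (Real.lt_log_iff_exp_lt hR).1 hζ.1.2⟩
  have hQb : ∀ ζ ∈ Q, Complex.exp ζ ∈ ball (0 : ℂ) R := fun ζ hζ => by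
    simpa using (hQn ζ hζ).2
  set Φ : ℂ → ℂ := fun ζ => p (Complex.exp ζ) with hΦ
  have hΦd : ∀ ζ ∈ Q, HasDerivAt Φ (deriv p (Complex.exp ζ) * Complex.exp ζ) ζ := fun ζ hζ =>
    ((hp.differentiableAt (isOpen_ball.mem_nhds (hQb ζ hζ))).hasDerivAt).comp ζ
      (Complex.hasDerivAt_exp ζ)
  have hΦi : InjOn Φ Q := fun x hx y hy h =>
    injOn_exp_strip _ hx hy (hinj (hQb x hx) (hQb y hy) h)
  have hPm : MeasurableSet (Φ '' Q) := measurableSet_image_of_hasDerivAt hQm hΦd hΦi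
  have hlow : ∀ ζ ∈ Q, c * δ ≤ ‖Φ ζ‖ := by
    intro ζ hζ
    by_contra! hlt
    obtain ⟨x, hx, hpx⟩ := hsurj _ (hlt.trans hδη)
    have hxδ : ‖x‖ < δ := hx.trans_lt (by rwa [div_lt_iff₀ hc0, mul_comm])
    have := hinj (by simpa using hxδ.trans hδR) (hQb ζ hζ) hpx
    rw [this] at hxδ
    exact lt_asymm hxδ (hQn ζ hζ).1
  have hup : ∀ ζ ∈ Q, ‖Φ ζ‖ ≤ (c * δ)⁻¹ := by
    intro ζ hζ
    by_contra! hlt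
    have hpos : 0 < ‖Φ ζ‖ := hcδ.trans_le (hlow ζ hζ)
    have hlt' : ‖(Φ ζ)⁻¹‖ < c * δ := by
      rw [norm_inv]; exact inv_lt_of_inv_lt₀ hcδ hlt
    obtain ⟨x, hx, hpx⟩ := hsurj _ (hlt'.trans hδη)
    have hxδ : ‖x‖ < δ := hx.trans_lt (by rwa [div_lt_iff₀ hc0, mul_comm])
    refine hBE x (by simpa using hxδ.trans hδR) _ (hQb ζ hζ) ?_
    rw [hpx]
    exact inv_mul_cancel₀ (norm_pos_iff.1 hpos)
  have hP0 : (0 : ℂ) ∉ Φ '' Q := by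
    rintro ⟨ζ, hζ, h⟩
    have := hlow ζ hζ
    rw [h, norm_zero] at this
    linarith
  have hdisj : Disjoint (Φ '' Q) ((fun w => w⁻¹) '' (Φ '' Q)) := by
    rw [Set.disjoint_left]
    rintro _ ⟨x, hx, rfl⟩ ⟨_, ⟨y, hy, rfl⟩, h⟩
    refine hBE _ (hQb x hx) _ (hQb y hy) ?_
    have hy0 : Φ y ≠ 0 := fun h => hP0 ⟨y, hy, h⟩
    change Φ x * Φ y = 1
    rw [← h]
    exact inv_mul_cancel₀ hy0
  have hinvm : MeasurableSet ((fun w : ℂ => w⁻¹) '' (Φ '' Q)) := by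
    rw [Set.image_inv_eq_inv]
    exact hPm.inv
  have hupper : logArea (Φ '' Q) + logArea (Φ '' Q) ≤
      ENNReal.ofReal (2 * Real.pi) * ENNReal.ofReal (-Real.log (c * δ) - Real.log (c * δ)) := by
    have h1 : logArea (Φ '' Q) + logArea ((fun w => w⁻¹) '' (Φ '' Q)) =
        logArea (Φ '' Q ∪ (fun w => w⁻¹) '' (Φ '' Q)) := (lintegral_union hinvm hdisj).symm
    rw [logArea_inv hPm hP0] at h1
    rw [h1]
    refine le_trans (lintegral_mono_set ?_) logArea_annulus_le
    rw [Real.exp_neg, Real.exp_log hcδ]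
    rintro _ (⟨ζ, hζ, rfl⟩ | ⟨_, ⟨ζ, hζ, rfl⟩, rfl⟩)
    · exact ⟨hlow ζ hζ, hup ζ hζ⟩
    · have hpos : 0 < ‖Φ ζ‖ := hcδ.trans_le (hlow ζ hζ)
      simp only [mem_ofPred_eq, norm_inv]
      exact ⟨le_inv_of_le_inv₀ hpos (hup ζ hζ), inv_anti₀ hcδ (hlow ζ hζ)⟩
  -- lower bound
  have hslope0 : ∀ x ∈ ball (0 : ℂ) R, dslope p 0 x ≠ 0 := by
    intro x hx
    by_cases hx0 : x = 0
    · rw [hx0, dslope_same]; exact hd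
    · rw [dslope_of_ne _ hx0, slope_def_field, h0, sub_zero, sub_zero]
      refine div_ne_zero (fun h => hx0 ?_) hx0
      exact hinj hx (mem_ball_self hR) (h.trans h0.symm)
  set k : ℂ → ℂ := fun x => deriv p x / dslope p 0 x with hk
  have hkd : DifferentiableOn ℂ k (ball 0 R) :=
    (hp.deriv isOpen_ball).div ((Complex.differentiableOn_dslope hball).2 hp) hslope0
  have hk0 : k 0 = 1 := by simp [hk, hd]
  have hlower : ENNReal.ofReal (2 * Real.pi) * ENNReal.ofReal (Real.log R - Real.log δ) ≤
      logArea (Φ '' Q) := by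
    rw [logArea_image hQm hΦd hΦi]
    have hcongr : ∫⁻ ζ in Q, ENNReal.ofReal
          ((‖deriv p (Complex.exp ζ) * Complex.exp ζ‖ / ‖Φ ζ‖) ^ 2) =
        ∫⁻ ζ in Q, ENNReal.ofReal (‖k (Complex.exp ζ)‖ ^ 2) := by
      refine setLIntegral_congr_fun hQm fun ζ _ => ?_
      simp only [hk, hΦ]
      rw [← norm_div, dslope_of_ne _ (Complex.exp_ne_zero ζ), slope_def_field, h0, sub_zero,
        sub_zero, div_div_eq_mul_div]
    rw [hcongr, setLIntegral_reProdIm]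
    · calc _ = ∫⁻ _ in Ioo (Real.log δ) (Real.log R), ENNReal.ofReal (2 * Real.pi) := by
            simp
        _ ≤ _ := by
            refine setLIntegral_mono' measurableSet_Ioo fun a ha => ?_
            exact two_pi_le_lintegral_circle hkd hk0 ((Real.lt_log_iff_exp_lt hR).1 ha.2)
    · refine ContinuousOn.aemeasurable ?_ hQm
      refine ENNReal.continuous_ofReal.comp_continuousOn (ContinuousOn.pow ?_ 2)
      exact (hkd.continuousOn.comp Complex.continuous_exp.continuousOn hQb).norm
  have hfin := (add_le_add hlower hlower).trans hupper
  have hlogR : 0 ≤ Real.log R - Real.log δ := sub_nonneg.2 (Real.log_le_log hδ0 hδR.le)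
  rw [← mul_add, ← ENNReal.ofReal_add hlogR hlogR,
    ENNReal.mul_le_mul_iff_right (by simpa using Real.pi_pos) ENNReal.ofReal_ne_top] at hfin
  have hlog : Real.log (c * R) ≤ 0 := by
    rw [Real.log_mul hc0.ne' hR.ne']
    rw [Real.log_mul hc0.ne' hδ0.ne'] at hfin
    have hlt := Real.log_lt_log hδ0 hδR
    rcases ENNReal.ofReal_le_ofReal_iff'.1 hfin with h | h <;> linarith
  exact (Real.log_nonpos_iff (by positivity)).1 hlog

end CConvexVolume

namespace CConvexVolume

open Set Filter Topology Metric ComplexConjugate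

/-- Every nowhere zero holomorphic function on `Ω` has a holomorphic square root. -/
def HasHolomorphicSqrt (Ω : Set ℂ) : Prop :=
  ∀ h : ℂ → ℂ, DifferentiableOn ℂ h Ω → (∀ x ∈ Ω, h x ≠ 0) →
    ∃ k : ℂ → ℂ, DifferentiableOn ℂ k Ω ∧ ∀ x ∈ Ω, k x ^ 2 = h x

/-- An injective holomorphic map of `Ω` into the unit disc without critical points. -/
structure IsDiscEmbedding (Ω : Set ℂ) (f : ℂ → ℂ) : Prop where
  differentiableOn : DifferentiableOn ℂ f Ω
  mapsTo : MapsTo f Ω (ball 0 1)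
  injOn : InjOn f Ω
  deriv_ne_zero : ∀ x ∈ Ω, deriv f x ≠ 0

theorem deriv_of_sq_eq {Ω : Set ℂ} (hΩ : IsOpen Ω) {f s : ℂ → ℂ} (hs : DifferentiableOn ℂ s Ω)
    (hsf : ∀ x ∈ Ω, s x ^ 2 = f x) {x : ℂ} (hx : x ∈ Ω) :
    2 * s x * deriv s x = deriv f x := by
  have h1 := ((hs.differentiableAt (hΩ.mem_nhds hx)).hasDerivAt.pow 2)
  have h2 : deriv (s ^ 2) x = deriv f x :=
    EventuallyEq.deriv_eq (by
      filter_upwards [hΩ.mem_nhds hx] with y hy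
      simpa using hsf y hy)
  rw [← h2, h1.deriv]
  norm_num

theorem IsDiscEmbedding.sqrt {Ω : Set ℂ} (hΩ : IsOpen Ω) {f s : ℂ → ℂ} (hf : IsDiscEmbedding Ω f)
    (hs : DifferentiableOn ℂ s Ω) (hsf : ∀ x ∈ Ω, s x ^ 2 = f x) : IsDiscEmbedding Ω s where
  differentiableOn := hs
  mapsTo x hx := by
    have h1 : ‖f x‖ < 1 := by simpa using hf.mapsTo hx
    rw [← hsf x hx, norm_pow] at h1
    simpa using (pow_lt_one_iff_of_nonneg (norm_nonneg (s x)) two_ne_zero).1 h1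
  injOn x hx y hy h := hf.injOn hx hy (by rw [← hsf x hx, ← hsf y hy, h])
  deriv_ne_zero x hx h := hf.deriv_ne_zero x hx (by rw [← deriv_of_sq_eq hΩ hs hsf hx, h, mul_zero])

theorem one_sub_conj_mul_ne_zero {a w : ℂ} (ha : ‖a‖ < 1) (hw : ‖w‖ < 1) :
    1 - conj a * w ≠ 0 := by
  intro h
  have h1 : conj a * w = 1 := (sub_eq_zero.1 h).symm
  have h2 : ‖a‖ * ‖w‖ = 1 := by simpa using congrArg norm h1
  nlinarith [norm_nonneg a, norm_nonneg w]

theorem norm_mobius_lt_one {a w : ℂ} (ha : ‖a‖ < 1) (hw : ‖w‖ < 1) :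
    ‖(w - a) / (1 - conj a * w)‖ < 1 := by
  rw [norm_div, div_lt_one (norm_pos_iff.2 (one_sub_conj_mul_ne_zero ha hw)),
    ← pow_lt_pow_iff_left₀ (norm_nonneg _) (norm_nonneg _) two_ne_zero]
  have h1 : ‖a‖ ^ 2 < 1 := pow_lt_one₀ (norm_nonneg _) ha two_ne_zero
  have h2 : ‖w‖ ^ 2 < 1 := pow_lt_one₀ (norm_nonneg _) hw two_ne_zero
  rw [Complex.sq_norm, Complex.normSq_apply] at h1 h2 ⊢
  rw [Complex.sq_norm, Complex.normSq_apply]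
  simp only [Complex.sub_re, Complex.sub_im, Complex.one_re, Complex.one_im, Complex.mul_re,
    Complex.mul_im, Complex.conj_re, Complex.conj_im]
  nlinarith [mul_pos (sub_pos.2 h1) (sub_pos.2 h2)]

theorem hasDerivAt_mobius_comp {f : ℂ → ℂ} {x a f' : ℂ} (hf : HasDerivAt f f' x) (ha : ‖a‖ < 1)
    (hfx : ‖f x‖ < 1) :
    HasDerivAt (fun w => (f w - a) / (1 - conj a * f w))
      ((1 - ‖a‖ ^ 2) * f' / (1 - conj a * f x) ^ 2) x := by
  have h0 := one_sub_conj_mul_ne_zero ha hfx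
  have := (hf.sub_const a).div ((hf.const_mul (conj a)).const_sub 1) h0
  refine this.congr_deriv ?_
  have h2 : conj a * a = (‖a‖ : ℂ) ^ 2 := Complex.conj_mul' a
  rw [← h2]
  congr 1
  ring

theorem IsDiscEmbedding.mobius {Ω : Set ℂ} (hΩ : IsOpen Ω) {f : ℂ → ℂ} (hf : IsDiscEmbedding Ω f)
    {a : ℂ} (ha : ‖a‖ < 1) :
    IsDiscEmbedding Ω fun w => (f w - a) / (1 - conj a * f w) := by
  have hfn : ∀ x ∈ Ω, ‖f x‖ < 1 := fun x hx => by simpa using hf.mapsTo hx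
  have hder : ∀ x ∈ Ω, HasDerivAt (fun w => (f w - a) / (1 - conj a * f w))
      ((1 - ‖a‖ ^ 2) * deriv f x / (1 - conj a * f x) ^ 2) x := fun x hx =>
    hasDerivAt_mobius_comp (hf.differentiableOn.differentiableAt (hΩ.mem_nhds hx)).hasDerivAt ha
      (hfn x hx)
  have ha2 : (1 - (‖a‖ : ℂ) ^ 2) ≠ 0 := by
    have : 1 - ‖a‖ ^ 2 ≠ 0 := (sub_pos.2 (pow_lt_one₀ (norm_nonneg _) ha two_ne_zero)).ne'
    exact_mod_cast this
  refine ⟨fun x hx => (hder x hx).differentiableAt.differentiableWithinAt, fun x hx => ?_,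
    fun x hx y hy h => ?_, fun x hx => ?_⟩
  · simpa using norm_mobius_lt_one ha (hfn x hx)
  · refine hf.injOn hx hy ?_
    rw [div_eq_div_iff (one_sub_conj_mul_ne_zero ha (hfn x hx))
      (one_sub_conj_mul_ne_zero ha (hfn y hy))] at h
    have h2 : conj a * a = (‖a‖ : ℂ) ^ 2 := Complex.conj_mul' a
    have h3 : (1 - (‖a‖ : ℂ) ^ 2) * (f x - f y) = 0 := by
      rw [← h2]; linear_combination h
    exact sub_eq_zero.1 ((mul_eq_zero.1 h3).resolve_left ha2)
  · rw [(hder x hx).deriv]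
    exact div_ne_zero (mul_ne_zero ha2 (hf.deriv_ne_zero x hx))
      (pow_ne_zero _ (one_sub_conj_mul_ne_zero ha (hfn x hx)))

/-- If a normalised disc embedding omits a value `a` of the disc, a square root transformation
increases its derivative by the factor `(1 + |a|) / (2 √|a|)`. -/
theorem IsDiscEmbedding.exists_larger {Ω : Set ℂ} (hΩ : IsOpen Ω) (hsq : HasHolomorphicSqrt Ω)
    (h0 : (0 : ℂ) ∈ Ω) {f : ℂ → ℂ} (hf : IsDiscEmbedding Ω f) (hf0 : f 0 = 0) {a : ℂ}
    (ha : ‖a‖ < 1) (haf : a ∉ f '' Ω) :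
    ∃ F, IsDiscEmbedding Ω F ∧ F 0 = 0 ∧
      ‖deriv F 0‖ = (1 + ‖a‖) / (2 * √‖a‖) * ‖deriv f 0‖ := by
  have ha0 : a ≠ 0 := fun h => haf ⟨0, h0, by rw [hf0, h]⟩
  have hfn : ∀ x ∈ Ω, ‖f x‖ < 1 := fun x hx => by simpa using hf.mapsTo hx
  have hg := hf.mobius hΩ ha
  set g : ℂ → ℂ := fun w => (f w - a) / (1 - conj a * f w) with hgdef
  obtain ⟨s, hsd, hss⟩ := hsq g hg.differentiableOn fun x hx =>
    div_ne_zero (sub_ne_zero.2 fun h => haf ⟨x, hx, h⟩)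
      (one_sub_conj_mul_ne_zero ha (hfn x hx))
  have hs := hg.sqrt hΩ hsd hss
  have hs0 : ‖s 0‖ < 1 := by simpa using hs.mapsTo h0
  have hs0sq : ‖s 0‖ ^ 2 = ‖a‖ := by
    rw [← norm_pow, hss 0 h0]; simp [hgdef, hf0]
  have hs0pos : 0 < ‖s 0‖ := by
    refine (norm_nonneg _).lt_of_ne fun h => norm_ne_zero_iff.2 ha0 ?_
    rw [← hs0sq, ← h]; norm_num
  have hsqrt : √‖a‖ = ‖s 0‖ := by rw [← hs0sq, Real.sqrt_sq hs0pos.le]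
  refine ⟨_, hs.mobius hΩ hs0, by simp, ?_⟩
  have hg' : deriv g 0 = (1 - ‖a‖ ^ 2) * deriv f 0 := by
    have := (hasDerivAt_mobius_comp
      (hf.differentiableOn.differentiableAt (hΩ.mem_nhds h0)).hasDerivAt ha (hfn 0 h0)).deriv
    rw [hf0] at this
    simpa using this
  have hs' := deriv_of_sq_eq hΩ hsd hss h0
  rw [(hasDerivAt_mobius_comp (hsd.differentiableAt (hΩ.mem_nhds h0)).hasDerivAt hs0 hs0).deriv]
  have h2 : conj (s 0) * s 0 = (‖s 0‖ : ℂ) ^ 2 := Complex.conj_mul' _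
  rw [h2, hsqrt, ← hs0sq]
  have hns : ‖deriv s 0‖ * (2 * ‖s 0‖) = (1 - (‖s 0‖ ^ 2) ^ 2) * ‖deriv f 0‖ := by
    have h3 := congrArg norm (hs'.trans hg')
    have h4 : ‖(1 : ℂ) - (‖a‖ : ℂ) ^ 2‖ = 1 - ‖a‖ ^ 2 := by
      rw [show (1 : ℂ) - (‖a‖ : ℂ) ^ 2 = ((1 - ‖a‖ ^ 2 : ℝ) : ℂ) by push_cast; ring,
        Complex.norm_real, Real.norm_of_nonneg]
      exact (sub_pos.2 (pow_lt_one₀ (norm_nonneg _) ha two_ne_zero)).le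
    rw [norm_mul, norm_mul, norm_mul, h4, ← hs0sq] at h3
    rw [← h3]; simp; ring
  have hpos : 0 < 1 - ‖s 0‖ ^ 2 := sub_pos.2 (pow_lt_one₀ (norm_nonneg _) hs0 two_ne_zero)
  have h5 : ‖(1 : ℂ) - (‖s 0‖ : ℂ) ^ 2‖ = 1 - ‖s 0‖ ^ 2 := by
    rw [show (1 : ℂ) - (‖s 0‖ : ℂ) ^ 2 = ((1 - ‖s 0‖ ^ 2 : ℝ) : ℂ) by push_cast; ring,
      Complex.norm_real, Real.norm_of_nonneg hpos.le]
  rw [norm_div, norm_mul, norm_pow, h5]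
  have hds : ‖deriv s 0‖ = (1 - (‖s 0‖ ^ 2) ^ 2) * ‖deriv f 0‖ / (2 * ‖s 0‖) := by
    rw [eq_div_iff (by positivity), hns]
  rw [hds]
  field_simp
  ring

/-- On a plane set with square roots omitting `1`, there is an injective holomorphic function
vanishing at `0` no two of whose values have product `1`, with derivative of modulus `1/4`. -/
theorem exists_mul_ne_one {Ω : Set ℂ} (hΩ : IsOpen Ω) (hsq : HasHolomorphicSqrt Ω)
    (h0 : (0 : ℂ) ∈ Ω) (h1 : (1 : ℂ) ∉ Ω) :
    ∃ q : ℂ → ℂ, DifferentiableOn ℂ q Ω ∧ InjOn q Ω ∧ (∀ x ∈ Ω, deriv q x ≠ 0) ∧ q 0 = 0 ∧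
      ‖deriv q 0‖ = 1 / 4 ∧ ∀ x ∈ Ω, ∀ y ∈ Ω, q x * q y ≠ 1 := by
  obtain ⟨g, hgd, hg⟩ := hsq (fun w => 1 - w) (by fun_prop) fun x hx h =>
    h1 (by rwa [← sub_eq_zero.1 h] at hx)
  obtain ⟨G, hGd, hG, hG0⟩ : ∃ G : ℂ → ℂ, DifferentiableOn ℂ G Ω ∧ (∀ x ∈ Ω, G x ^ 2 = 1 - x) ∧
      G 0 = 1 := by
    have hg0 : g 0 ^ 2 = 1 := by simpa using hg 0 h0
    exact ⟨fun x => g 0 * g x, hgd.const_mul _, fun x hx => by rw [mul_pow, hg0, hg x hx, one_mul],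
      by simpa only [sq] using hg0⟩
  have hne : ∀ x ∈ Ω, ∀ y ∈ Ω, G x + G y ≠ 0 := by
    intro x hx y hy h
    have hxy : x = y := by
      have : G x ^ 2 = G y ^ 2 := by rw [eq_neg_of_add_eq_zero_left h]; ring
      rw [hG x hx, hG y hy] at this
      linear_combination -this
    subst hxy
    have h2 : G x = 0 := by linear_combination h / 2
    have := hG x hx
    rw [h2] at this
    exact h1 (by rwa [show x = 1 by linear_combination this] at hx)
  have hne1 : ∀ x ∈ Ω, G x + 1 ≠ 0 := fun x hx => by
    have := hne x hx 0 h0; rwa [hG0] at this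
  have hGx : ∀ x ∈ Ω, G x ≠ 0 := fun x hx h => hne x hx x hx (by rw [h, add_zero])
  have hder : ∀ x ∈ Ω, HasDerivAt (fun w => (G w - 1) / (G w + 1))
      (-1 / (G x * (G x + 1) ^ 2)) x := by
    intro x hx
    have hd := (hGd.differentiableAt (hΩ.mem_nhds hx)).hasDerivAt
    have h2 : 2 * G x * deriv G x = -1 := by
      rw [deriv_of_sq_eq hΩ hGd hG hx]
      simp
    refine ((hd.sub_const 1).div (hd.add_const 1) (hne1 x hx)).congr_deriv ?_
    have := hne1 x hx
    have := hGx x hx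
    field_simp
    linear_combination h2
  refine ⟨fun w => (G w - 1) / (G w + 1),
    fun x hx => (hder x hx).differentiableAt.differentiableWithinAt, fun x hx y hy h => ?_,
    fun x hx => ?_, by simp [hG0], ?_, fun x hx y hy h => ?_⟩
  · simp only at h
    rw [div_eq_div_iff (hne1 x hx) (hne1 y hy)] at h
    have h2 : G x = G y := by linear_combination h / 2
    have h3 := hG x hx
    rw [h2, hG y hy] at h3
    linear_combination h3
  · rw [(hder x hx).deriv]
    exact div_ne_zero (by simp) (mul_ne_zero (hGx x hx) (pow_ne_zero _ (hne1 x hx)))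
  · rw [(hder 0 h0).deriv, hG0]
    norm_num
  · rw [div_mul_div_comm, div_eq_one_iff_eq (mul_ne_zero (hne1 x hx) (hne1 y hy))] at h
    exact hne x hx y hy (by linear_combination -h / 2)

/-- The Koebe quarter theorem in extremal form: a plane set with holomorphic square roots that
omits `1` has holomorphic maps to the disc fixing `0`, with derivative almost `1/4`. -/
theorem exists_mapsTo_ball_le_deriv {Ω : Set ℂ} (hΩ : IsOpen Ω) (hsq : HasHolomorphicSqrt Ω)
    (h0 : (0 : ℂ) ∈ Ω) (h1 : (1 : ℂ) ∉ Ω) {R : ℝ} (hR0 : 0 < R) (hR : R < 1) :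
    ∃ f : ℂ → ℂ, DifferentiableOn ℂ f Ω ∧ MapsTo f Ω (ball 0 1) ∧ f 0 = 0 ∧
      R / 4 ≤ ‖deriv f 0‖ := by
  obtain ⟨q, hqd, hqi, hq', hq0, hq4, hqq⟩ := exists_mul_ne_one hΩ hsq h0 h1
  have hΩ0 := hΩ.mem_nhds h0
  -- a bounded multiple of `q` is a disc embedding
  obtain ⟨f₀, hf₀, hf₀0⟩ : ∃ f, IsDiscEmbedding Ω f ∧ f 0 = 0 := by
    have himg : q '' Ω ∈ 𝓝 (0 : ℂ) := by
      have hst : HasStrictDerivAt q (deriv q 0) 0 := (hqd.analyticAt hΩ0).hasStrictDerivAt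
      have := hst.map_nhds_eq (hq' 0 h0)
      rw [hq0] at this
      rw [← this]
      exact image_mem_map hΩ0
    obtain ⟨r, hr, hball⟩ := Metric.mem_nhds_iff.1 himg
    have hbd : ∀ x ∈ Ω, ‖q x‖ ≤ r⁻¹ := by
      intro x hx
      by_contra! hlt
      have hpos : 0 < ‖q x‖ := (inv_pos.2 hr).trans hlt
      obtain ⟨y, hy, hyx⟩ := hball (show (q x)⁻¹ ∈ ball (0 : ℂ) r by
        rw [mem_ball_zero_iff, norm_inv]; exact inv_lt_of_inv_lt₀ hr hlt)
      exact hqq y hy x hx (by rw [hyx]; exact inv_mul_cancel₀ (norm_pos_iff.1 hpos))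
    have hr2 : ((r / 2 : ℝ) : ℂ) ≠ 0 := by exact_mod_cast (half_pos hr).ne'
    refine ⟨fun x => ((r / 2 : ℝ) : ℂ) * q x, ⟨hqd.const_mul _, fun x hx => ?_,
      fun x hx y hy h => hqi hx hy (mul_left_cancel₀ hr2 h), fun x hx => ?_⟩, by simp [hq0]⟩
    · rw [mem_ball_zero_iff, norm_mul, Complex.norm_real, Real.norm_of_nonneg (half_pos hr).le]
      calc r / 2 * ‖q x‖ ≤ r / 2 * r⁻¹ := by gcongr; exact hbd x hx
        _ < 1 := by field_simp; norm_num
    · rw [deriv_const_mul _ (hqd.differentiableAt (hΩ.mem_nhds hx))]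
      exact mul_ne_zero hr2 (hq' x hx)
  set S : Set ℝ := {m | ∃ f, IsDiscEmbedding Ω f ∧ f 0 = 0 ∧ ‖deriv f 0‖ = m} with hS
  have hSb : BddAbove S := by
    obtain ⟨d, hd, hball⟩ := Metric.mem_nhds_iff.1 hΩ0
    refine ⟨1 / d, ?_⟩
    rintro _ ⟨f, hf, hf0, rfl⟩
    refine Complex.norm_deriv_le_div_of_mapsTo_ball (hf.differentiableOn.mono hball)
      (fun x hx => ?_) hd
    rw [hf0]
    exact ball_subset_closedBall (hf.mapsTo (hball hx))
  have hMpos : 0 < sSup S :=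
    (norm_pos_iff.2 (hf₀.deriv_ne_zero 0 h0)).trans_le (le_csSup hSb ⟨f₀, hf₀, hf₀0, rfl⟩)
  set c : ℝ := (1 + R) / (2 * √R) with hc
  have hsR : 0 < √R := Real.sqrt_pos.2 hR0
  have hsR1 : √R < 1 := by rw [Real.sqrt_lt' one_pos]; simpa using hR
  have hRsq : √R ^ 2 = R := Real.sq_sqrt hR0.le
  have hc1 : 1 < c := by
    rw [hc, one_lt_div (by positivity)]
    nlinarith [sq_pos_of_pos (sub_pos.2 hsR1)]
  obtain ⟨_, ⟨f, hf, hf0, rfl⟩, hlt⟩ := exists_lt_of_lt_csSup (s := S)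
    ⟨_, f₀, hf₀, hf₀0, rfl⟩ (div_lt_self hMpos hc1)
  have hfpos : 0 < ‖deriv f 0‖ := norm_pos_iff.2 (hf.deriv_ne_zero 0 h0)
  refine ⟨f, hf.differentiableOn, hf.mapsTo, hf0, ?_⟩
  have hsurj : ball (0 : ℂ) R ⊆ f '' Ω := by
    intro a ha
    by_contra hcon
    have haR : ‖a‖ < R := by simpa using ha
    have ha0 : 0 < ‖a‖ := norm_pos_iff.2 fun h => hcon ⟨0, h0, by rw [hf0, h]⟩
    obtain ⟨F, hF, hF0, hFd⟩ := hf.exists_larger hΩ hsq h0 hf0 (haR.trans hR) hcon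
    have hle : ‖deriv F 0‖ ≤ sSup S := le_csSup hSb ⟨F, hF, hF0, rfl⟩
    have hfac : c ≤ (1 + ‖a‖) / (2 * √‖a‖) := by
      have hsa : 0 < √‖a‖ := Real.sqrt_pos.2 ha0
      have hle' : √‖a‖ ≤ √R := Real.sqrt_le_sqrt haR.le
      have hasq : √‖a‖ ^ 2 = ‖a‖ := Real.sq_sqrt ha0.le
      rw [hc, div_le_div_iff₀ (by positivity) (by positivity)]
      have : √‖a‖ * √R ≤ 1 := by nlinarith
      nlinarith [mul_nonneg (sub_nonneg.2 hle') (sub_nonneg.2 this)]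
    rw [div_lt_iff₀ (by linarith)] at hlt
    rw [hFd] at hle
    nlinarith [mul_le_mul_of_nonneg_right hfac hfpos.le]
  set g : ℂ → ℂ := Function.invFunOn f Ω with hg
  have hgf : ∀ x ∈ Ω, g (f x) = x := fun x hx => hf.injOn.leftInvOn_invFunOn hx
  have hgder : ∀ x ∈ Ω, HasDerivAt g (deriv f x)⁻¹ (f x) := by
    intro x hx
    have hst : HasStrictDerivAt f (deriv f x) x :=
      (hf.differentiableOn.analyticAt (hΩ.mem_nhds hx)).hasStrictDerivAt
    refine (hst.to_local_left_inverse (hf.deriv_ne_zero x hx) ?_).hasDerivAt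
    filter_upwards [hΩ.mem_nhds hx] with y hy using hgf y hy
  have hgΩ : ∀ y ∈ ball (0 : ℂ) R, g y ∈ Ω := fun y hy => by
    obtain ⟨x, hx, rfl⟩ := hsurj hy
    rw [hgf x hx]; exact hx
  have hpder : ∀ x ∈ Ω, HasDerivAt (fun y => q (g y)) (deriv q x * (deriv f x)⁻¹) (f x) := by
    intro x hx
    refine HasDerivAt.comp (f x) (h₂ := q) ?_ (hgder x hx)
    rw [hgf x hx]
    exact (hqd.differentiableAt (hΩ.mem_nhds hx)).hasDerivAt
  have hp0 := (hpder 0 h0).deriv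
  rw [hf0] at hp0
  have hg0 : g 0 = 0 := by rw [← hf0, hgf 0 h0, hf0]
  have key := norm_deriv_mul_le_one_of_mul_ne_one (p := fun y => q (g y)) hR0
    (fun y hy => by
      obtain ⟨x, hx, rfl⟩ := hsurj hy
      exact (hpder x hx).differentiableAt.differentiableWithinAt)
    (fun y hy y' hy' h => by
      have h2 := hqi (hgΩ y hy) (hgΩ y' hy') h
      obtain ⟨x, hx, rfl⟩ := hsurj hy
      obtain ⟨x', hx', rfl⟩ := hsurj hy'
      rw [hgf x hx, hgf x' hx'] at h2
      rw [h2])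
    (by simp only [hg0, hq0])
    (by rw [hp0]; exact mul_ne_zero (hq' 0 h0) (inv_ne_zero (hf.deriv_ne_zero 0 h0)))
    (fun x hx y hy => hqq _ (hgΩ x hx) _ (hgΩ y hy))
  rw [hp0, norm_mul, hq4, norm_inv] at key
  field_simp at key
  linarith

end CConvexVolume

namespace CConvexVolume

open Set Filter Topology Metric

theorem differentiableOn_of_sq_eq {Ω : Set ℂ} (hΩ : IsOpen Ω) {h k : ℂ → ℂ}
    (hh : DifferentiableOn ℂ h Ω) (h0 : ∀ x ∈ Ω, h x ≠ 0) (hk : ContinuousOn k Ω)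
    (hkh : ∀ x ∈ Ω, k x ^ 2 = h x) : DifferentiableOn ℂ k Ω := by
  intro x hx
  have hk0 : k x ≠ 0 := fun h' => h0 x hx (by rw [← hkh x hx, h']; norm_num)
  have hkx : ContinuousAt k x := hk.continuousAt (hΩ.mem_nhds hx)
  have hsum : ∀ᶠ y in 𝓝 x, k y + k x ≠ 0 :=
    (hkx.add continuousAt_const).eventually_ne (by simpa [← two_mul] using hk0)
  have hsl := hasDerivAt_iff_tendsto_slope.1
    (hh.differentiableAt (hΩ.mem_nhds hx)).hasDerivAt
  have hd : HasDerivAt k (deriv h x / (k x + k x)) x := by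
    rw [hasDerivAt_iff_tendsto_slope]
    have hlim : Tendsto (fun y => slope h x y / (k y + k x)) (𝓝[≠] x)
        (𝓝 (deriv h x / (k x + k x))) :=
      hsl.div ((hkx.add continuousAt_const).tendsto.mono_left nhdsWithin_le_nhds)
        (by simpa [← two_mul] using hk0)
    refine hlim.congr' ?_
    filter_upwards [nhdsWithin_le_nhds hsum, nhdsWithin_le_nhds (hΩ.mem_nhds hx)] with y hy hyΩ
    rw [slope_def_field, slope_def_field, ← hkh y hyΩ, ← hkh x hx]
    rw [show k y ^ 2 - k x ^ 2 = (k y - k x) * (k y + k x) by ring]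
    field_simp
  exact hd.differentiableAt.differentiableWithinAt

theorem hasHolomorphicSqrt_image {E : Type*} [NormedAddCommGroup E] [NormedSpace ℂ E] {D : Set E}
    (hD : IsOpen D) (hsc : SliceSimplyConnected D) (L : E →L[ℂ] ℂ) {u : E} (hu : L u = 1) :
    HasHolomorphicSqrt (L '' D) := by
  intro h hh h0
  obtain ⟨f, hf, hfe⟩ := exists_log_on_image hD hsc L hu hh.continuousOn h0
  have hΩ : IsOpen (L '' D) :=
    L.isOpenMap_of_ne_zero (fun hL => by simp [hL] at hu) D hD
  have hsq : ∀ x ∈ L '' D, Complex.exp (f x / 2) ^ 2 = h x := fun x hx => by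
    rw [← Complex.exp_nat_mul, ← hfe x hx]
    congr 1
    push_cast
    ring
  exact ⟨fun x => Complex.exp (f x / 2), differentiableOn_of_sq_eq hΩ hh h0
    (Complex.continuous_exp.comp_continuousOn (hf.div_const 2)) hsq, hsq⟩

variable {n : ℕ}

theorem norm_det_le_one (T : Cn n →L[ℂ] Cn n) (hT : ‖T‖ ≤ 1) : ‖T.det‖ ≤ 1 := by
  let _ : NormedSpace ℝ (Cn n) := NormedSpace.restrictScalars ℝ ℂ (Cn n)
  let _ : MeasurableSpace (Cn n) := borel _
  have : BorelSpace (Cn n) := ⟨rfl⟩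
  have : FiniteDimensional ℝ (Cn n) := FiniteDimensional.complexToReal _
  have h1 := MeasureTheory.Measure.addHaar_image_linearMap
    (MeasureTheory.Measure.addHaar : MeasureTheory.Measure (Cn n))
    ((T : Cn n →ₗ[ℂ] Cn n).restrictScalars ℝ) (ball 0 1)
  have h2 : ((T : Cn n →ₗ[ℂ] Cn n).restrictScalars ℝ) '' ball 0 1 ⊆ ball 0 1 := by
    rintro _ ⟨x, hx, rfl⟩
    rw [mem_ball_zero_iff] at hx ⊢
    exact ((T.le_opNorm x).trans (mul_le_of_le_one_left (norm_nonneg _) hT)).trans_lt hx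
  have h3 := (MeasureTheory.measure_mono
    (μ := (MeasureTheory.Measure.addHaar : MeasureTheory.Measure (Cn n))) h2)
  rw [h1, LinearMap.det_restrictScalars, Algebra.norm_complex_apply, Complex.normSq_eq_norm_sq,
    abs_of_nonneg (by positivity)] at h3
  have h4 : ENNReal.ofReal (‖LinearMap.det (T : Cn n →ₗ[ℂ] Cn n)‖ ^ 2) ≤ 1 := by
    have hpos := measure_ball_pos
      (MeasureTheory.Measure.addHaar : MeasureTheory.Measure (Cn n)) (0 : Cn n) one_pos
    refine (ENNReal.mul_le_mul_iff_left hpos.ne' MeasureTheory.measure_ball_lt_top.ne).1 ?_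
    rwa [one_mul]
  rw [ENNReal.ofReal_le_one] at h4
  exact (pow_le_one_iff_of_nonneg (norm_nonneg _) two_ne_zero).1 h4

theorem caratheodoryVol_le_kobayashiVol {D : Set (Cn n)} (hD : IsOpen D) {z : Cn n} (hz : z ∈ D) :
    caratheodoryVol D z ≤ kobayashiVol D z := by
  refine sSup_le ?_
  rintro _ ⟨φ, hφ, hφm, hφz, rfl⟩
  refine le_sInf ?_
  rintro _ ⟨ψ, hψ, hψm, hψ0, rfl⟩
  have hd1 : DifferentiableAt ℂ φ (ψ 0) := by
    rw [hψ0]; exact hφ.differentiableAt (hD.mem_nhds hz)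
  have hd2 : DifferentiableAt ℂ ψ 0 := hψ.differentiableAt (ball_mem_nhds _ one_pos)
  have h1 : ‖(fderiv ℂ (φ ∘ ψ) 0).det‖ ≤ 1 := by
    refine norm_det_le_one _ (Complex.norm_fderiv_le_one_of_mapsTo_ball (hφ.comp hψ hψm)
      (fun x hx => ?_) one_pos)
    have : (φ ∘ ψ) 0 = 0 := by simp [hψ0, hφz]
    rw [this]
    exact ball_subset_closedBall (hφm (hψm hx))
  rw [fderiv_comp _ hd1 hd2, hψ0] at h1
  have h2 : ((fderiv ℂ φ z).comp (fderiv ℂ ψ 0)).det =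
      (fderiv ℂ φ z).det * (fderiv ℂ ψ 0).det := LinearMap.det_comp _ _
  rw [h2, norm_mul] at h1
  rw [ENNReal.le_inv_iff_mul_le, ← ENNReal.ofReal_mul (by positivity), ENNReal.ofReal_le_one,
    ← mul_pow]
  exact pow_le_one₀ (by positivity) h1

theorem exists_mem_frontier_of_notMem {D : Set (Cn n)} (hD : IsOpen D) {z x : Cn n} (hz : z ∈ D)
    (hx : x ∉ D) : ∃ t : ℝ, 0 ≤ t ∧ t ≤ 1 ∧ z + (t : ℂ) • (x - z) ∈ frontier D := by
  by_contra! hcon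
  have hc : Continuous fun t : ℝ => z + (t : ℂ) • (x - z) := by fun_prop
  have hsub : Icc (0 : ℝ) 1 ⊆ (fun t : ℝ => z + (t : ℂ) • (x - z)) ⁻¹' D ∪
      (fun t : ℝ => z + (t : ℂ) • (x - z)) ⁻¹' (closure D)ᶜ := by
    intro t ht
    have h1 := hcon t ht.1 ht.2
    rw [hD.frontier_eq] at h1
    by_cases h2 : z + (t : ℂ) • (x - z) ∈ D
    · exact Or.inl h2
    · exact Or.inr fun h3 => h1 ⟨h3, h2⟩
  have := isPreconnected_Icc.subset_left_of_subset_union (hD.preimage hc)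
    (isClosed_closure.isOpen_compl.preimage hc)
    (Set.disjoint_left.2 fun t h1 h2 => h2 (subset_closure h1)) hsub
    ⟨0, by simp, by simpa using hz⟩
  exact hx (by simpa using this (show (1 : ℝ) ∈ Icc (0 : ℝ) 1 by simp))

theorem add_smul_mem_orthoSlice {z x : Cn n} {p : Fin n → Cn n} {j : Fin n}
    (hx : x ∈ orthoSlice z p j) (c : ℂ) : z + c • (x - z) ∈ orthoSlice z p j := by
  intro i hi
  rw [add_sub_cancel_left, inner_smul_right, hx i hi, mul_zero]

theorem isClosed_orthoSlice (z : Cn n) (p : Fin n → Cn n) (j : Fin n) :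
    IsClosed (orthoSlice z p j) := by
  have : orthoSlice z p j = ⋂ i, ⋂ (_ : i < j), {w | inner ℂ (p i - z) (w - z) = 0} := by
    ext w; simp [orthoSlice]
  rw [this]
  exact isClosed_iInter fun i => isClosed_iInter fun _ =>
    isClosed_eq (by fun_prop) continuous_const

theorem orthoSlice_congr {z : Cn n} {p p' : Fin n → Cn n} {j : Fin n} (h : ∀ i < j, p i = p' i) :
    orthoSlice z p j = orthoSlice z p' j := by
  ext w
  exact forall₂_congr fun i hi => by rw [h i hi]

theorem frontier_inter_orthoSlice_nonempty {D : Set (Cn n)} (hD : IsOpen D)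
    (hnd : IsNondegenerate D) {z : Cn n} (hz : z ∈ D) (p : Fin n → Cn n) (j : Fin n) :
    (frontier D ∩ orthoSlice z p j).Nonempty := by
  set V : Submodule ℂ (Cn n) :=
    Submodule.span ℂ (range fun i : Fin j => p (i.castLE j.2.le) - z) with hV
  have hVtop : V ≠ ⊤ := by
    intro h
    have h1 : Module.finrank ℂ V ≤ j := by
      have := finrank_range_le_card (R := ℂ) fun i : Fin j => p (i.castLE j.2.le) - z
      rwa [Fintype.card_fin] at this
    rw [h, finrank_top, finrank_euclideanSpace, Fintype.card_fin] at h1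
    exact absurd j.2 (not_lt.2 h1)
  have hbot : Vᗮ ≠ ⊥ := fun h => hVtop (Submodule.orthogonal_eq_bot_iff.1 h)
  obtain ⟨v, hv, hv0⟩ := Submodule.exists_mem_ne_zero_of_ne_bot hbot
  obtain ⟨x, ⟨t, rfl⟩, hx⟩ := not_subset.1 (hnd z v hv0)
  have hxs : z + t • v ∈ orthoSlice z p j := by
    intro i hi
    have := (Submodule.mem_orthogonal _ _).1 hv (p i - z)
      (Submodule.subset_span ⟨⟨i, hi⟩, rfl⟩)
    rw [add_sub_cancel_left, inner_smul_right, this, mul_zero]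
  obtain ⟨s, -, -, hs⟩ := exists_mem_frontier_of_notMem hD hz hx
  exact ⟨_, hs, add_smul_mem_orthoSlice hxs _⟩

theorem exists_isMinimalFrame {D : Set (Cn n)} (hD : IsOpen D) (hnd : IsNondegenerate D)
    {z : Cn n} (hz : z ∈ D) : ∃ p, IsMinimalFrame D z p := by
  suffices h : ∀ m ≤ n, ∃ p : Fin n → Cn n, ∀ j : Fin n, (j : ℕ) < m →
      p j ∈ frontier D ∩ orthoSlice z p j ∧
      ∀ q ∈ frontier D ∩ orthoSlice z p j, dist z (p j) ≤ dist z q by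
    obtain ⟨p, hp⟩ := h n le_rfl
    exact ⟨p, fun j => (hp j j.2).1, fun j => (hp j j.2).2⟩
  intro m
  induction m with
  | zero => exact fun _ => ⟨fun _ => z, fun j hj => absurd hj (Nat.not_lt_zero _)⟩
  | succ m ih =>
    intro hm
    obtain ⟨p, hp⟩ := ih (by omega)
    set k : Fin n := ⟨m, hm⟩ with hk
    have hne := frontier_inter_orthoSlice_nonempty hD hnd hz p k
    obtain ⟨y, hy, hyd⟩ := (isClosed_frontier.inter (isClosed_orthoSlice z p k)).exists_infDist_eq_dist
      hne z
    refine ⟨Function.update p k y, fun j hj => ?_⟩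
    have hs : orthoSlice z (Function.update p k y) j = orthoSlice z p j :=
      orthoSlice_congr fun i hi => Function.update_of_ne (by
        rintro rfl
        have : (k : ℕ) < j := hi
        simp only [hk] at this
        omega) _ _
    rw [hs]
    by_cases hjk : j = k
    · subst hjk
      rw [Function.update_self]
      exact ⟨hy, fun q hq => hyd ▸ infDist_le_dist_of_mem hq⟩
    · rw [Function.update_of_ne hjk]
      refine hp j ?_
      have : (j : ℕ) ≠ m := fun h => hjk (Fin.ext h)
      omega

namespace IsMinimalFrame

variable {D : Set (Cn n)} {z : Cn n} {p : Fin n → Cn n}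

theorem notMem (hp : IsMinimalFrame D z p) (hD : IsOpen D) (j : Fin n) : p j ∉ D := by
  have := (hp.mem j).1
  rw [hD.frontier_eq] at this
  exact this.2

theorem mem_of_dist_lt (hp : IsMinimalFrame D z p) (hD : IsOpen D) (hz : z ∈ D) {j : Fin n}
    {x : Cn n} (hx : x ∈ orthoSlice z p j) (hd : dist z x < dist z (p j)) : x ∈ D := by
  by_contra hxD
  obtain ⟨t, ht0, ht1, ht⟩ := exists_mem_frontier_of_notMem hD hz hxD
  have h1 := hp.dist_le j _ ⟨ht, add_smul_mem_orthoSlice hx _⟩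
  have h2 : dist z (z + (t : ℂ) • (x - z)) ≤ dist z x := by
    rw [dist_self_add_right, norm_smul, Complex.norm_real, Real.norm_of_nonneg ht0, dist_comm z x,
      dist_eq_norm]
    exact mul_le_of_le_one_left (norm_nonneg _) ht1
  linarith

theorem sub_ne_zero (hp : IsMinimalFrame D z p) (hD : IsOpen D) (hz : z ∈ D) (j : Fin n) :
    p j - z ≠ 0 := fun h => hp.notMem hD j (by rwa [_root_.sub_eq_zero.1 h])

theorem inner_eq_zero (hp : IsMinimalFrame D z p) {i j : Fin n} (hij : i ≠ j) :
    inner ℂ (p i - z) (p j - z) = 0 := by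
  rcases lt_or_gt_of_ne hij with h | h
  · exact (hp.mem j).2 i h
  · exact inner_eq_zero_symm.1 ((hp.mem i).2 j h)

theorem add_smul_mem (hp : IsMinimalFrame D z p) (hD : IsOpen D) (hz : z ∈ D) (j : Fin n) {c : ℂ}
    (hc : ‖c‖ < 1) : z + c • (p j - z) ∈ D := by
  refine hp.mem_of_dist_lt hD hz (add_smul_mem_orthoSlice (hp.mem j).2 c) ?_
  rw [dist_self_add_right, norm_smul, dist_comm, dist_eq_norm]
  exact mul_lt_of_lt_one_left (norm_pos_iff.2 (hp.sub_ne_zero hD hz j)) hc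

/-- A supporting functional at `p j`, normalised to be `1` on `p j - z`, vanishes on the later
frame vectors. -/
theorem exists_functional (hp : IsMinimalFrame D z p) (hD : IsOpen D)
    (hsc : SliceSimplyConnected D) (hz : z ∈ D) (j : Fin n) :
    ∃ L : Cn n →L[ℂ] ℂ, L (p j - z) = 1 ∧ (∀ w ∈ D, L (w - z) ≠ 1) ∧
      ∀ i, j < i → L (p i - z) = 0 := by
  obtain ⟨l, hl⟩ := exists_functional_ne_zero hD hsc ⟨z, hz⟩ (hp.notMem hD j)
  have hlu : l (p j - z) ≠ 0 := fun h => hl z hz (by rw [← neg_sub, map_neg, h, neg_zero])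
  set L : Cn n →L[ℂ] ℂ := (l (p j - z))⁻¹ • l with hL
  have hLu : L (p j - z) = 1 := inv_mul_cancel₀ hlu
  have hLne : ∀ w ∈ D, L (w - z) ≠ 1 := by
    intro w hw h
    refine hl w hw ?_
    have h1 : l (w - z) = l (p j - z) := by
      simp only [hL, smul_apply, smul_eq_mul] at h
      field_simp at h
      exact h
    rw [← sub_sub_sub_cancel_right w (p j) z, map_sub, h1, sub_self]
  refine ⟨L, hLu, hLne, fun i hi => ?_⟩
  by_contra hv
  set v := p i - z with hvdef
  set u := p j - z with hudef
  have huv : inner ℂ u v = 0 := hp.inner_eq_zero hi.ne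
  have hτ : 0 < ‖u‖ := norm_pos_iff.2 (hp.sub_ne_zero hD hz j)
  have hv0 : 0 < ‖v‖ := norm_pos_iff.2 (hp.sub_ne_zero hD hz i)
  -- vectors orthogonal to the earlier ones satisfy `‖u‖ |L x| ≤ ‖x‖`
  have hbound : ∀ s : ℝ, 0 < s → ‖u‖ ^ 2 * (1 + s) ^ 2 ≤ ‖u‖ ^ 2 + (s * (‖v‖ / ‖L v‖)) ^ 2 := by
    intro s hs
    set x := u + ((s : ℂ) / L v) • v with hx
    have hLx : L x = ((1 + s : ℝ) : ℂ) := by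
      simp [hx, hLu, div_mul_cancel₀ _ hv]
    have hs1 : 0 < 1 + s := by linarith
    have hLx0 : L x ≠ 0 := by rw [hLx]; exact_mod_cast hs1.ne'
    have hnot : z + (L x)⁻¹ • x ∉ D := fun h => hLne _ h (by
      rw [add_sub_cancel_left, map_smul, smul_eq_mul, inv_mul_cancel₀ hLx0])
    have hslice : z + (L x)⁻¹ • x ∈ orthoSlice z p j := by
      intro i' hi'
      rw [add_sub_cancel_left, inner_smul_right, hx, inner_add_right, inner_smul_right,
        (hp.mem j).2 i' hi', hp.inner_eq_zero (hi'.trans hi).ne]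
      simp
    have hdist : ‖u‖ ≤ ‖(L x)⁻¹ • x‖ := by
      by_contra! hlt
      refine hnot (hp.mem_of_dist_lt hD hz hslice ?_)
      rwa [dist_self_add_right, dist_comm, dist_eq_norm]
    rw [norm_smul, norm_inv, hLx, Complex.norm_real, Real.norm_of_nonneg hs1.le,
      inv_mul_eq_div, le_div_iff₀ hs1] at hdist
    have hnx : ‖x‖ ^ 2 = ‖u‖ ^ 2 + (s * (‖v‖ / ‖L v‖)) ^ 2 := by
      have := norm_add_sq_eq_norm_sq_add_norm_sq_of_inner_eq_zero (𝕜 := ℂ) u (((s : ℂ) / L v) • v)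
        (by rw [inner_smul_right, huv, mul_zero])
      rw [hx, sq, this, norm_smul, norm_div, Complex.norm_real, Real.norm_of_nonneg hs.le]
      ring
    rw [← hnx, ← mul_pow]
    exact pow_le_pow_left₀ (by positivity) hdist 2
  have hK : 0 < ‖v‖ / ‖L v‖ := div_pos hv0 (norm_pos_iff.2 hv)
  set K := ‖v‖ / ‖L v‖ with hKdef
  have h := hbound (‖u‖ ^ 2 / K ^ 2) (by positivity)
  have h2 : (‖u‖ ^ 2 / K ^ 2 * K) ^ 2 = ‖u‖ ^ 2 * (‖u‖ ^ 2 / K ^ 2) := by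
    field_simp
  rw [h2] at h
  have h3 : 0 < ‖u‖ ^ 2 / K ^ 2 := by positivity
  have h4 : 0 < ‖u‖ ^ 2 := by positivity
  nlinarith [mul_pos h4 h3, mul_pos h4 (mul_pos h3 h3)]

end IsMinimalFrame

theorem det_eq_det_of (T : Cn n →L[ℂ] Cn n) :
    T.det = (Matrix.of fun i j => T (EuclideanSpace.single j 1) i).det := by
  have := LinearMap.det_toMatrix (EuclideanSpace.basisFun (Fin n) ℂ).toBasis (T : Cn n →ₗ[ℂ] Cn n)
  rw [ContinuousLinearMap.det, ← this]
  congr 1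

/-- The linear map sending the standard basis to the vectors `u j`. -/
noncomputable def frameMap (u : Fin n → Cn n) : Cn n →L[ℂ] Cn n :=
  ∑ j, (EuclideanSpace.proj j : Cn n →L[ℂ] ℂ).smulRight (u j)

theorem frameMap_apply (u : Fin n → Cn n) (x : Cn n) : frameMap u x = ∑ j, x j • u j := by
  simp [frameMap]

theorem frameMap_single (u : Fin n → Cn n) (j : Fin n) :
    frameMap u (EuclideanSpace.single j 1) = u j := by
  rw [frameMap_apply, Finset.sum_eq_single j] <;> simp +contextual

theorem norm_det_frameMap {u : Fin n → Cn n} (hu : ∀ i j, i ≠ j → inner ℂ (u i) (u j) = 0) :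
    ‖(frameMap u).det‖ = ∏ j, ‖u j‖ := by
  rw [det_eq_det_of]
  set M : Matrix (Fin n) (Fin n) ℂ :=
    Matrix.of fun i j => frameMap u (EuclideanSpace.single j 1) i with hM
  have h : M.conjTranspose * M = Matrix.diagonal fun j => ((‖u j‖ ^ 2 : ℝ) : ℂ) := by
    ext i j
    have h1 : (M.conjTranspose * M) i j = inner ℂ (u i) (u j) := by
      rw [Matrix.mul_apply, PiLp.inner_apply]
      refine Finset.sum_congr rfl fun k _ => ?_
      simp [hM, frameMap_single, mul_comm]
    rw [h1]
    by_cases hij : i = j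
    · subst hij
      rw [Matrix.diagonal_apply_eq, inner_self_eq_norm_sq_to_K]
      simp
    · rw [Matrix.diagonal_apply_ne _ hij, hu i j hij]
  have h2 := congrArg (fun N => ‖Matrix.det N‖) h
  simp only [Matrix.det_mul, Matrix.det_conjTranspose, Matrix.det_diagonal, norm_mul,
    norm_star, norm_prod, Complex.norm_real, norm_pow, norm_norm, Finset.prod_pow] at h2
  rw [← sq] at h2
  exact (pow_left_inj₀ (norm_nonneg _) (Finset.prod_nonneg fun _ _ => norm_nonneg _)
    two_ne_zero).1 h2

theorem sum_norm_lt_sqrt (hn : 0 < n) {x : Cn n} (hx : ‖x‖ < 1) : ∑ j, ‖x j‖ < √n := by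
  have h1 : (∑ j, ‖x j‖) ^ 2 ≤ n * ∑ j, ‖x j‖ ^ 2 := by
    simpa using sq_sum_le_card_mul_sum_sq (s := Finset.univ) (f := fun j => ‖x j‖)
  rw [← EuclideanSpace.norm_sq_eq] at h1
  have hn' : (0 : ℝ) < n := by exact_mod_cast hn
  refine Real.lt_sqrt_of_sq_lt (h1.trans_lt ?_)
  have : ‖x‖ ^ 2 < 1 := pow_lt_one₀ (norm_nonneg _) hx two_ne_zero
  nlinarith

theorem kobayashiVol_mul_le (hn : 0 < n) {D : Set (Cn n)} (hD : IsOpen D)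
    (hsc : SliceSimplyConnected D) {z : Cn n} (hz : z ∈ D) {p : Fin n → Cn n}
    (hp : IsMinimalFrame D z p) :
    kobayashiVol D z * ENNReal.ofReal (frameProd z p ^ 2) ≤ ENNReal.ofReal ((n : ℝ) ^ n) := by
  have hn' : (0 : ℝ) < n := by exact_mod_cast hn
  have hs : 0 < √(n : ℝ) := Real.sqrt_pos.2 hn'
  set T : Cn n →L[ℂ] Cn n := ((√n : ℝ) : ℂ)⁻¹ • frameMap fun j => p j - z with hT
  have hmaps : MapsTo (fun x => z + T x) (ball 0 1) D := by
    intro x hx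
    rw [mem_ball_zero_iff] at hx
    by_contra hcon
    obtain ⟨l, hl⟩ := exists_functional_ne_zero hD hsc ⟨z, hz⟩ hcon
    have hlT : l (T x) ≠ 0 := fun h => hl z hz (by
      rw [sub_add_cancel_left, map_neg, h, neg_zero])
    have hlu : ∀ j, ‖l (p j - z)‖ ≤ ‖l (T x)‖ := by
      intro j
      by_contra! hlt
      have hlj : l (p j - z) ≠ 0 := norm_pos_iff.1 ((norm_nonneg _).trans_lt hlt)
      refine hl _ (hp.add_smul_mem hD hz j (c := l (T x) / l (p j - z)) ?_) ?_
      · rw [norm_div, div_lt_one (norm_pos_iff.2 hlj)]; exact hlt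
      · rw [add_sub_add_left_eq_sub, map_sub, map_smul, smul_eq_mul, div_mul_cancel₀ _ hlj,
          sub_self]
    have hTx : l (T x) = ((√n : ℝ) : ℂ)⁻¹ * ∑ j, x j * l (p j - z) := by
      simp [hT, frameMap_apply]
    have hlt : ‖l (T x)‖ < ‖l (T x)‖ := by
      calc ‖l (T x)‖ = (√n)⁻¹ * ‖∑ j, x j * l (p j - z)‖ := by
            conv_lhs => rw [hTx]
            rw [norm_mul, norm_inv, Complex.norm_real, Real.norm_of_nonneg hs.le]
        _ ≤ (√n)⁻¹ * ∑ j, ‖x j‖ * ‖l (T x)‖ := by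
            gcongr
            refine (norm_sum_le _ _).trans (Finset.sum_le_sum fun j _ => ?_)
            rw [norm_mul]
            gcongr
            exact hlu j
        _ = (∑ j, ‖x j‖) / √n * ‖l (T x)‖ := by rw [← Finset.sum_mul]; ring
        _ < 1 * ‖l (T x)‖ := by
            have := norm_pos_iff.2 hlT
            gcongr
            rw [div_lt_one hs]
            exact sum_norm_lt_sqrt hn hx
        _ = ‖l (T x)‖ := one_mul _
    exact lt_irrefl _ hlt
  have hder : fderiv ℂ (fun x => z + T x) 0 = T := by
    rw [fderiv_const_add]; exact T.fderiv
  have hdet : ‖T.det‖ ^ 2 = ((n : ℝ) ^ n)⁻¹ * frameProd z p ^ 2 := by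
    have h1 : T.det = (((√n : ℝ) : ℂ)⁻¹) ^ n * (frameMap fun j => p j - z).det := by
      have := LinearMap.det_smul (((√n : ℝ) : ℂ)⁻¹)
        ((frameMap fun j => p j - z : Cn n →L[ℂ] Cn n) : Cn n →ₗ[ℂ] Cn n)
      rw [finrank_euclideanSpace, Fintype.card_fin] at this
      exact this
    rw [h1, norm_mul, norm_det_frameMap fun i j hij => hp.inner_eq_zero hij, norm_pow, norm_inv,
      Complex.norm_real, Real.norm_of_nonneg hs.le, mul_pow, ← pow_mul, mul_comm n 2, pow_mul,
      inv_pow, Real.sq_sqrt hn'.le, inv_pow]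
    rfl
  have hP : 0 < frameProd z p :=
    Finset.prod_pos fun j _ => norm_pos_iff.2 (hp.sub_ne_zero hD hz j)
  have hk : kobayashiVol D z ≤ (ENNReal.ofReal (((n : ℝ) ^ n)⁻¹ * frameProd z p ^ 2))⁻¹ := by
    refine sInf_le ⟨fun x => z + T x, ?_, hmaps, by simp, by rw [hder, hdet]⟩
    exact (T.differentiable.const_add z).differentiableOn
  refine (mul_le_mul_left hk _).trans (le_of_eq ?_)
  rw [← ENNReal.ofReal_inv_of_pos (by positivity), ← ENNReal.ofReal_mul (by positivity)]
  congr 1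
  field_simp

theorem le_caratheodoryVol_mul (hn : 0 < n) {D : Set (Cn n)} (hD : IsOpen D)
    (hsc : SliceSimplyConnected D) {z : Cn n} (hz : z ∈ D) {p : Fin n → Cn n}
    (hp : IsMinimalFrame D z p) {R : ℝ} (hR0 : 0 < R) (hR1 : R < 1) :
    ENNReal.ofReal ((R ^ 2) ^ n / (16 * (n : ℝ)) ^ n) ≤
      caratheodoryVol D z * ENNReal.ofReal (frameProd z p ^ 2) := by
  have hn' : (0 : ℝ) < n := by exact_mod_cast hn
  have hs : 0 < √(n : ℝ) := Real.sqrt_pos.2 hn'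
  choose L hLu hLne hL0 using fun j => hp.exists_functional hD hsc hz j
  set D₀ : Set (Cn n) := {x | z + x ∈ D} with hD₀
  have hD₀o : IsOpen D₀ := hD.preimage (by fun_prop)
  have hsc₀ : SliceSimplyConnected D₀ := fun x y hxy => by
    have := hsc (z + x) y (by simpa [hD₀, add_assoc] using hxy)
    simpa [hD₀, add_assoc] using this
  have hf : ∀ j, ∃ f : ℂ → ℂ, DifferentiableOn ℂ f (L j '' D₀) ∧
      MapsTo f (L j '' D₀) (ball 0 1) ∧ f 0 = 0 ∧ R / 4 ≤ ‖deriv f 0‖ := fun j =>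
    exists_mapsTo_ball_le_deriv
      ((L j).isOpenMap_of_ne_zero (fun h => by simpa [h] using hLu j) D₀ hD₀o)
      (hasHolomorphicSqrt_image hD₀o hsc₀ (L j) (hLu j))
      ⟨0, by simpa [hD₀] using hz, map_zero _⟩
      (by
        rintro ⟨x, hx, h⟩
        exact hLne j _ hx (by rwa [add_sub_cancel_left])) hR0 hR1
  choose f hfd hfm hf0 hfR using hf
  have hmem : ∀ j, ∀ w ∈ D, L j (w - z) ∈ L j '' D₀ := fun j w hw =>
    ⟨w - z, by simpa [hD₀] using hw, rfl⟩
  set ψ : Cn n → Cn n := fun w =>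
    WithLp.toLp 2 fun j => ((√n : ℝ) : ℂ)⁻¹ * f j (L j (w - z)) with hψ
  have hopen : ∀ j, IsOpen (L j '' D₀) := fun j =>
    (L j).isOpenMap_of_ne_zero (fun h => by simpa [h] using hLu j) D₀ hD₀o
  have hψd : DifferentiableOn ℂ ψ D := by
    rw [differentiableOn_euclidean]
    intro j
    refine DifferentiableOn.const_mul ?_ _
    exact (hfd j).comp ((L j).differentiable.comp (differentiable_id.sub_const z)).differentiableOn
      (hmem j)
  have hψm : MapsTo ψ D (ball 0 1) := by
    intro w hw
    rw [mem_ball_zero_iff, ← sq_lt_one_iff₀ (norm_nonneg _), EuclideanSpace.norm_sq_eq]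
    calc ∑ j, ‖ψ w j‖ ^ 2 = ∑ j, (n : ℝ)⁻¹ * ‖f j (L j (w - z))‖ ^ 2 := by
          refine Finset.sum_congr rfl fun j _ => ?_
          simp only [hψ]
          rw [norm_mul, norm_inv, Complex.norm_real, Real.norm_of_nonneg hs.le, mul_pow, inv_pow,
            Real.sq_sqrt hn'.le]
      _ < ∑ _j : Fin n, (n : ℝ)⁻¹ * 1 := by
          refine Finset.sum_lt_sum_of_nonempty ⟨⟨0, hn⟩, Finset.mem_univ _⟩ fun j _ => ?_
          have : ‖f j (L j (w - z))‖ < 1 := by simpa using hfm j (hmem j w hw)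
          have := pow_lt_one₀ (norm_nonneg _) this two_ne_zero
          gcongr
      _ = 1 := by simp [hn'.ne']
  have hψz : ψ z = 0 := by
    ext j; simp [hψ, hf0]
  -- the derivative in the frame is triangular
  have hder : ∀ j v, (fderiv ℂ ψ z v) j = ((√n : ℝ) : ℂ)⁻¹ * (deriv (f j) 0 * L j v) := by
    intro j v
    have h1 := (hψd.differentiableAt (hD.mem_nhds hz)).hasFDerivAt
    have h2 := (hasFDerivWithinAt_euclidean.1 h1.hasFDerivWithinAt j :
      HasFDerivWithinAt (fun x => ψ x j) _ univ z).hasFDerivAt univ_mem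
    have h3 : HasDerivAt (f j) (deriv (f j) 0) (L j (z - z)) := by
      rw [sub_self, map_zero]
      refine ((hfd j).differentiableAt ((hopen j).mem_nhds ?_)).hasDerivAt
      simpa using hmem j z hz
    have h4 : HasFDerivAt (fun w => L j (w - z)) (L j) z :=
      (L j).hasFDerivAt.comp z ((hasFDerivAt_id z).sub_const z)
    have h5 := (h3.comp_hasFDerivAt z h4).const_mul (((√n : ℝ) : ℂ)⁻¹)
    have h6 := h2.unique h5
    have h7 := congrArg (fun A : Cn n →L[ℂ] ℂ => A v) h6
    simpa using h7
  have hdet : ‖(fderiv ℂ ψ z).det‖ ^ 2 * frameProd z p ^ 2 =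
      ((n : ℝ) ^ n)⁻¹ * (∏ j, ‖deriv (f j) 0‖) ^ 2 := by
    have h1 : (fderiv ℂ ψ z).det * (frameMap fun j => p j - z).det =
        ∏ j, (((√n : ℝ) : ℂ)⁻¹ * deriv (f j) 0) := by
      have h2 : ((fderiv ℂ ψ z).comp (frameMap fun j => p j - z)).det =
          (fderiv ℂ ψ z).det * (frameMap fun j => p j - z).det := LinearMap.det_comp _ _
      rw [← h2, det_eq_det_of, Matrix.det_of_isLowerTriangular]
      · refine Finset.prod_congr rfl fun j _ => ?_
        rw [Matrix.of_apply, ContinuousLinearMap.comp_apply, frameMap_single, hder, hLu, mul_one]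
      · intro i j hij
        have hij' : i < j := hij
        rw [Matrix.of_apply, ContinuousLinearMap.comp_apply, frameMap_single, hder, hL0 i j hij',
          mul_zero, mul_zero]
    have h3 := congrArg (fun c : ℂ => ‖c‖ ^ 2) h1
    simp only [norm_mul, norm_prod] at h3
    rw [norm_det_frameMap fun i j hij => hp.inner_eq_zero hij, mul_pow] at h3
    rw [frameProd, h3, Finset.prod_mul_distrib, mul_pow]
    congr 1
    rw [Finset.prod_const, Finset.card_univ, Fintype.card_fin, norm_inv, Complex.norm_real,
      Real.norm_of_nonneg hs.le, ← pow_mul, mul_comm n 2, pow_mul, inv_pow, Real.sq_sqrt hn'.le,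
      inv_pow]
  have hc : ENNReal.ofReal (‖(fderiv ℂ ψ z).det‖ ^ 2) ≤ caratheodoryVol D z :=
    le_sSup ⟨ψ, hψd, hψm, hψz, rfl⟩
  refine le_trans ?_ (mul_le_mul_left hc _)
  rw [← ENNReal.ofReal_mul (by positivity), hdet]
  refine ENNReal.ofReal_le_ofReal ?_
  have hprod : (R / 4) ^ n ≤ ∏ j, ‖deriv (f j) 0‖ := by
    have := Finset.prod_le_prod (s := Finset.univ) (f := fun _ : Fin n => R / 4)
      (g := fun j => ‖deriv (f j) 0‖) (fun _ _ => by positivity) fun j _ => hfR j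
    rwa [Finset.prod_const, Finset.card_univ, Fintype.card_fin] at this
  calc (R ^ 2) ^ n / (16 * (n : ℝ)) ^ n = ((n : ℝ) ^ n)⁻¹ * ((R / 4) ^ n) ^ 2 := by
        rw [mul_pow, ← pow_mul, ← pow_mul, div_pow, mul_comm n 2, pow_mul 4 2 n]
        norm_num
        field_simp
    _ ≤ _ := by gcongr

end CConvexVolume

theorem mainTheorem2 (n : ℕ) (hn : 2 ≤ n) (D : Set (CConvexVolume.Cn n))
    (hD : CConvexVolume.IsDomainSet D) (hconv : CConvexVolume.IsCConvex D)
    (hnd : CConvexVolume.IsNondegenerate D) (z : CConvexVolume.Cn n) (hz : z ∈ D) :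
    (∃ p : Fin n → CConvexVolume.Cn n, CConvexVolume.IsMinimalFrame D z p) ∧
    ∀ p : Fin n → CConvexVolume.Cn n, CConvexVolume.IsMinimalFrame D z p →
      ∀ v : ℝ≥0∞, v = CConvexVolume.caratheodoryVol D z ∨ v = CConvexVolume.kobayashiVol D z →
        ENNReal.ofReal (1 / (16 * (n : ℝ)) ^ n)
            ≤ v * ENNReal.ofReal (CConvexVolume.frameProd z p ^ 2) ∧
        v * ENNReal.ofReal (CConvexVolume.frameProd z p ^ 2)
            ≤ ENNReal.ofReal ((((4 : ℝ) ^ n - 1) / 3) ^ n) := by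
  have hn0 : 0 < n := by omega
  have hsc := hconv.sliceSimplyConnected
  refine ⟨CConvexVolume.exists_isMinimalFrame hD.1 hnd hz, fun p hp v hv => ?_⟩
  have hcv : CConvexVolume.caratheodoryVol D z ≤ v := by
    rcases hv with rfl | rfl
    · exact le_rfl
    · exact CConvexVolume.caratheodoryVol_le_kobayashiVol hD.1 hz
  have hvk : v ≤ CConvexVolume.kobayashiVol D z := by
    rcases hv with rfl | rfl
    · exact CConvexVolume.caratheodoryVol_le_kobayashiVol hD.1 hz
    · exact le_rfl
  constructor
  · refine le_trans ?_ (mul_le_mul_left hcv _)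
    have hlim : Filter.Tendsto
        (fun R : ℝ => ENNReal.ofReal ((R ^ 2) ^ n / (16 * (n : ℝ)) ^ n))
        (nhdsWithin 1 (Set.Iio 1)) (nhds (ENNReal.ofReal (1 / (16 * (n : ℝ)) ^ n))) := by
      have hcont : Continuous fun R : ℝ => ENNReal.ofReal ((R ^ 2) ^ n / (16 * (n : ℝ)) ^ n) :=
        ENNReal.continuous_ofReal.comp (by fun_prop)
      have := hcont.tendsto 1
      simp only [one_pow] at this
      exact this.mono_left nhdsWithin_le_nhds
    refine le_of_tendsto hlim ?_
    filter_upwards [Ioo_mem_nhdsLT (zero_lt_one' ℝ)] with R hR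
    exact CConvexVolume.le_caratheodoryVol_mul hn0 hD.1 hsc hz hp hR.1 hR.2
  · refine (mul_le_mul_left hvk _).trans
      ((CConvexVolume.kobayashiVol_mul_le hn0 hD.1 hsc hz hp).trans ?_)
    refine ENNReal.ofReal_le_ofReal (pow_le_pow_left₀ (by positivity) ?_ n)
    have := one_add_mul_le_pow (show (-2 : ℝ) ≤ 3 by norm_num) n
    norm_num at this
    linarith
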